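/- For $n\ge 1$ put $\Psi_1(n)=\prod_{p\mid n}(1+\tfrac1p)^{-1}$ and $\Psi(n)=\sum_{d\mid n}\Psi_1(d)\sum_{e\mid d}\frac{\mu(e)}{e}$. For coprime integers $0<a<b$, the nodal cubic $C_{a,b}:\ aw(z-1)^2=bz(w-1)^2$ is parametrised by the slope $\frac{z-1}{w-1}=\frac uv$, $[u:v]\in\mathbb P^1(\mathbb Q)$. For $u,v$ positive and coprime with $\sqrt{b/a}<u/v<b/a$ put $$d_{a,b}(u,v)=\frac{u^2/v^2-b/a}{b/a-u/v},\qquad H_{a,b}(u,v)=\frac{b\,\bigl(ua(u-v)\bigr)^2}{\bigl(\gcd(v,a)\gcd(u,b)\gcd(u-v,b-a)\bigr)^2}$$ ($d_{a,b}$ is the value of $z-1$ at the point of parameter $[u:v]$). For $B,\varepsilon>0$ let $E(a,b,\varepsilon,B,r)$ be the set of points $[u:v]\in\mathbb P^1(\mathbb Q)$, with $u,v$ positive coprime integers, such that $\sqrt{b/a}<u/v<b/a$, $B^{1/r}d_{a,b}(u,v)\le\varepsilon$ and $H_{a,b}(u,v)\le B$; let $E(a,b,\varepsilon_1,\varepsilon_2,B,r)$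 be defined in the same way with $\varepsilon_2<B^{1/r}d_{a,b}(u,v)\le\varepsilon_1$. Fix $\varepsilon_1>\varepsilon_2>0$, $\tau_1>\tau_2>1$ and $\delta>0$. Then for all real $r$ with $2<r<\frac{144}{55}$, all coprime integers $0<a<b$ not both perfect squares, and all real $B>0$ such that $$\tau_2^2<\frac ba<\tau_1^2\qquad\text{and}\qquad b^{17/2}\le\frac{16\,\tau_2}{\tau_1-1}\,B^{\frac12-\frac1r},$$ the sets $E(a,b,\varepsilon_i,B,r)$ are finite and $$\begin{aligned}\# E(a,b,\varepsilon_1,\varepsilon_2,B,r)&=\# E(a,b,\varepsilon_1,B,r)-\# E(a,b,\varepsilon_2,B,r)\\&=\frac{3}{2\pi^2}\,\frac{\Psi(b)\Psi(a)\Psi(b-a)}{b\,a^{1/2}}(\varepsilon_1-\varepsilon_2)B^{\frac12-\frac1r}+O\!\left(b^{\frac{23}{8}+\delta}B^{\frac34\left(\frac12-\frac1r\right)}\log B\right),\end{aligned}$$ where the implied constant depends only on $\tau_1,\tau_2,\varepsilon_1,\varepsilon_2$ and $\delta$. -/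

import Mathlib

/-- The multiplicative function `Ψ₁(n) = ∏_{p ∣ n} (1 + 1/p)⁻¹`. -/
noncomputable def Psi₁ (n : ℕ) : ℝ :=
  ∏ p ∈ n.primeFactors, (1 + 1 / (p : ℝ))⁻¹

/-- The multiplicative function `Ψ(n) = ∑_{d ∣ n} Ψ₁(d) ∑_{e ∣ d} μ(e)/e`. -/
noncomputable def Psi (n : ℕ) : ℝ :=
  ∑ d ∈ n.divisors, Psi₁ d * ∑ e ∈ d.divisors, (ArithmeticFunction.moebius e : ℝ) / (e : ℝ)

/-- The distance to the node `Q = (1, 1)` induced on the line with parameter `[u : v]` by the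
parametrisation of `C_{a,b} : a w (z - 1)² = b z (w - 1)²` by the slope `(z - 1)/(w - 1) = u/v`:
it is the value of `z - 1` at the point of parameter `[u : v]`. -/
noncomputable def nodalDist (a b u v : ℕ) : ℝ :=
  (((u : ℝ) / v) ^ 2 - (b : ℝ) / a) / ((b : ℝ) / a - (u : ℝ) / v)

/-- The height induced on the line with parameter `[u : v]` (`u`, `v` coprime):
`b (u a (u - v))² / (gcd(v, a) gcd(u, b) gcd(u - v, b - a))²`. -/
noncomputable def nodalHeight (a b u v : ℕ) : ℝ :=
  (b : ℝ) * ((u : ℝ) * a * ((u : ℝ) - v)) ^ 2 /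
    ((Nat.gcd v a : ℝ) * (Nat.gcd u b : ℝ) *
      (Int.gcd ((u : ℤ) - (v : ℤ)) ((b : ℤ) - (a : ℤ)) : ℝ)) ^ 2

/-- The set `E(a, b, ε, B, r)` of the rational points `[u : v]` of the projective line with
`√(b/a) < u/v < b/a`, zoomed distance at most `ε` and height at most `B`. A point of `ℙ¹(ℚ)` of
positive slope is represented by its unique pair of coprime positive integers. -/
def zoomSet (a b : ℕ) (ε B r : ℝ) : Set (ℕ × ℕ) :=
  {p | 0 < p.1 ∧ 0 < p.2 ∧ Nat.Coprime p.1 p.2 ∧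
    Real.sqrt ((b : ℝ) / a) < (p.1 : ℝ) / p.2 ∧ (p.1 : ℝ) / p.2 < (b : ℝ) / a ∧
    B ^ (1 / r) * nodalDist a b p.1 p.2 ≤ ε ∧
    nodalHeight a b p.1 p.2 ≤ B}

/-- The set `E(a, b, ε₁, ε₂, B, r)`: same as `zoomSet`, with zoomed distance in `(ε₂, ε₁]`. -/
def zoomAnnulus (a b : ℕ) (ε₁ ε₂ B r : ℝ) : Set (ℕ × ℕ) :=
  {p | 0 < p.1 ∧ 0 < p.2 ∧ Nat.Coprime p.1 p.2 ∧
    Real.sqrt ((b : ℝ) / a) < (p.1 : ℝ) / p.2 ∧ (p.1 : ℝ) / p.2 < (b : ℝ) / a ∧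
    ε₂ < B ^ (1 / r) * nodalDist a b p.1 p.2 ∧
    B ^ (1 / r) * nodalDist a b p.1 p.2 ≤ ε₁ ∧
    nodalHeight a b p.1 p.2 ≤ B}

/-! Put `s = √(b/a)`, `κ = ε B^(-1/r)`, `η = 1/2 - 1/r`. The distance condition confines the slope
`u/v` to `(s, s + w]`, where `s + w` is the positive root of a quadratic equation and `w` is about
`κ(s - 1)/2`. The height condition reads `u(u - v) ≤ T g`, with `T = √B/(a√b)` and `g` the product
of the three gcds. In so thin a sector `u(u - v)` is nearly `s(s - 1)v²`, so the condition is
squeezed between two of the form `v² ≤ Y g` (`zoomSet_squeeze`). As `a`, `b`, `b - a` are pairwise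
coprime, Möbius inversion over `g ∣ ab(b - a)` and over common divisors of `u, v` leaves lattice
points to be counted in thin triangles of height `V` and slope width `w`.

For fixed `a, b` the area of such a triangle has order `B^η`, far below its perimeter, of order
`B^(1/4)`, so a boundary estimate is useless. Instead, `s` is a quadratic irrational: on the lattice
the integer `a u² - b v²` is a nonzero multiple of the index, so in lattice coordinates the slope is
badly approximable with a constant about `1/a`, the same for every lattice
(`one_div_le_mul_abs_of_norm_dvd`). Dirichlet's theorem then gives a denominator `q` of size about
`1/√w`; blocks of `q` rows are equidistributed, and the count is the area up to `O(a V √w)`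
(`abs_sectorSum_sub_le_of_badlyApproximable`).

The main terms add up to an Euler product, which gives `Psi₁`, and then to the divisor sum `Psi
(ab(b - a))`. The errors add up to `b^(19/4) B^(η/2) log B`; the hypothesis on `b^(17/2)` exchanges
a power of `b` for `B^(η/4)` and gives the stated error. -/

/-! ### Floor sums over a block of rows -/

/-- Multiplication by the unit `p` followed by a translation permutes the residues modulo `q`. -/
theorem sum_range_emod_add_mul {q : ℕ} (hq : 0 < q) {p : ℤ} (hp : IsCoprime p (q : ℤ)) (y : ℤ) :
    ∑ i ∈ Finset.range q, (y + i * p) % (q : ℤ) = ∑ i ∈ Finset.range q, (i : ℤ) := by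
  have hq' : (0 : ℤ) < q := by exact_mod_cast hq
  have hinj : Set.InjOn (fun i : ℕ => ((y + i * p) % (q : ℤ)).toNat) (Finset.range q) := by
    intro i hi j hj hij
    have h1 := Int.emod_nonneg (y + i * p) hq'.ne'
    have h2 := Int.emod_nonneg (y + j * p) hq'.ne'
    have h3 : (y + i * p) % (q : ℤ) = (y + j * p) % (q : ℤ) := by
      simp only at hij; omega
    have h4 : (q : ℤ) ∣ (i - j) * p := by
      have h5 := Int.dvd_of_emod_eq_zero (Int.emod_eq_emod_iff_emod_sub_eq_zero.1 h3)
      have h6 : (i - j : ℤ) * p = y + i * p - (y + j * p) := by ring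
      rwa [h6]
    have h5 : (q : ℤ) ∣ (i - j : ℤ) := hp.symm.dvd_of_dvd_mul_right h4
    simp only [Finset.coe_range, Set.mem_Iio] at hi hj
    obtain ⟨c, hc⟩ := h5
    have : |(i : ℤ) - j| < q := by rw [abs_lt]; omega
    have := Int.eq_zero_of_abs_lt_dvd ⟨c, hc⟩ this
    omega
  have himg : (Finset.range q).image (fun i : ℕ => ((y + i * p) % (q : ℤ)).toNat)
      = Finset.range q := by
    apply Finset.eq_of_subset_of_card_le
    · intro x hx
      simp only [Finset.mem_image, Finset.mem_range] at hx ⊢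
      obtain ⟨i, hi, rfl⟩ := hx
      have h1 := Int.emod_nonneg (y + i * p) hq'.ne'
      have h2 := Int.emod_lt_of_pos (y + i * p) hq'
      omega
    · rw [Finset.card_image_of_injOn hinj]
  conv_rhs => rw [← himg, Finset.sum_image hinj]
  refine Finset.sum_congr rfl fun i _ => ?_
  rw [Int.toNat_of_nonneg (Int.emod_nonneg _ hq'.ne')]

/-- Up to the factor `q`, each floor is `⌊qy⌋ + ip` minus its residue modulo `q`. The residues have
a sum independent of `y`, so they cancel in the difference, as do the terms in `p`. -/
theorem sum_range_floor_add_mul_div {q : ℕ} (hq : 0 < q) {p : ℤ} (hp : IsCoprime p (q : ℤ))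
    (y z : ℝ) :
    ∑ i ∈ Finset.range q, ⌊y + i * (p / q : ℝ)⌋ - ∑ i ∈ Finset.range q, ⌊z + i * (p / q : ℝ)⌋
      = ⌊q * y⌋ - ⌊q * z⌋ := by
  have hq' : (0 : ℤ) < q := by exact_mod_cast hq
  have hqr : (0 : ℝ) < q := by exact_mod_cast hq
  have key : ∀ y : ℝ, (q : ℤ) * ∑ i ∈ Finset.range q, ⌊y + i * (p / q : ℝ)⌋ =
      q * ⌊q * y⌋ + (∑ i ∈ Finset.range q, (i : ℤ)) * p - ∑ i ∈ Finset.range q, (i : ℤ) := by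
    intro y
    have h : ∀ i : ℕ, (q : ℤ) * ⌊y + i * (p / q : ℝ)⌋
        = ⌊q * y⌋ + i * p - (⌊q * y⌋ + i * p) % (q : ℤ) := by
      intro i
      have : y + i * (p / q : ℝ) = (q * y + ((i * p : ℤ) : ℝ)) / (q : ℕ) := by
        push_cast; field_simp
      rw [this, Int.floor_div_natCast, Int.floor_add_intCast]
      have := Int.emod_add_mul_ediv (⌊q * y⌋ + i * p) q
      linarith
    rw [Finset.mul_sum, Finset.sum_congr rfl (fun i _ => h i), Finset.sum_sub_distrib,
      sum_range_emod_add_mul hq hp, Finset.sum_add_distrib, Finset.sum_mul]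
    simp
  have h1 := key y
  have h2 := key z
  have : (q : ℤ) * (∑ i ∈ Finset.range q, ⌊y + i * (p / q : ℝ)⌋ -
      ∑ i ∈ Finset.range q, ⌊z + i * (p / q : ℝ)⌋) = q * (⌊q * y⌋ - ⌊q * z⌋) := by
    rw [mul_sub, h1, h2]; ring
  exact mul_left_cancel₀ hq'.ne' this

/-- A block of consecutive terms of `i ↦ α + i s`, of length the denominator of a good rational
approximation of `s`, is equidistributed modulo one. -/
theorem abs_sum_floor_block_sub_le {q : ℕ} (hq : 0 < q) {p : ℤ} (hp : IsCoprime p (q : ℤ))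
    {s : ℝ} (hs : |s - p / q| ≤ 1 / (q * q : ℝ)) (y z : ℝ) :
    |((∑ i ∈ Finset.range q, (⌊y + i * s⌋ - ⌊z + i * s⌋) : ℤ) : ℝ) - q * (y - z)| ≤ 3 := by
  have hqr : (0 : ℝ) < q := by exact_mod_cast hq
  -- Over one block the drift from slope `s` to slope `p/q` is at most `1/q`. It is absorbed by
  -- moving `y` and `z` by `1/q`, hence `qy` and `qz` by `1` each; rounding costs one more, whence
  -- the bound 3.
  have hi : ∀ i ∈ Finset.range q, |i * s - i * (p / q : ℝ)| ≤ 1 / q := by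
    intro i hi
    rw [← mul_sub, abs_mul, Nat.abs_cast]
    have : (i : ℝ) ≤ q := by exact_mod_cast (Finset.mem_range.1 hi).le
    calc (i : ℝ) * |s - p / q| ≤ q * (1 / (q * q : ℝ)) := by gcongr
      _ = 1 / q := by field_simp
  have low : ∀ y : ℝ, ∑ i ∈ Finset.range q, ⌊(y - 1 / q) + i * (p / q : ℝ)⌋ ≤
      ∑ i ∈ Finset.range q, ⌊y + i * s⌋ := fun y =>
    Finset.sum_le_sum fun i h => Int.floor_le_floor (by linarith [(abs_le.1 (hi i h)).1])
  have upp : ∀ y : ℝ, ∑ i ∈ Finset.range q, ⌊y + i * s⌋ ≤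
      ∑ i ∈ Finset.range q, ⌊(y + 1 / q) + i * (p / q : ℝ)⌋ := fun y =>
    Finset.sum_le_sum fun i h => Int.floor_le_floor (by linarith [(abs_le.1 (hi i h)).2])
  have e1 := sum_range_floor_add_mul_div hq hp (y + 1 / q) (z - 1 / q)
  have e2 := sum_range_floor_add_mul_div hq hp (y - 1 / q) (z + 1 / q)
  have l1 := low y
  have l2 := low z
  have u1 := upp y
  have u2 := upp z
  rw [Finset.sum_sub_distrib]
  have m1 : (q : ℝ) * (y + 1 / q) = q * y + 1 := by field_simp
  have m2 : (q : ℝ) * (z + 1 / q) = q * z + 1 := by field_simp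
  have m3 : (q : ℝ) * (y - 1 / q) = q * y - 1 := by field_simp
  have m4 : (q : ℝ) * (z - 1 / q) = q * z - 1 := by field_simp
  rw [m1, m4] at e1
  rw [m3, m2] at e2
  have A : ∑ i ∈ Finset.range q, ⌊y + i * s⌋ - ∑ i ∈ Finset.range q, ⌊z + i * s⌋
      ≤ ⌊(q * y + 1 : ℝ)⌋ - ⌊(q * z - 1 : ℝ)⌋ := by linarith
  have B : ⌊(q * y - 1 : ℝ)⌋ - ⌊(q * z + 1 : ℝ)⌋ ≤
      ∑ i ∈ Finset.range q, ⌊y + i * s⌋ - ∑ i ∈ Finset.range q, ⌊z + i * s⌋ := by linarith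
  have A' := (Int.cast_le (R := ℝ)).2 A
  have B' := (Int.cast_le (R := ℝ)).2 B
  push_cast at A' B' ⊢
  rw [abs_le]
  constructor
  · linarith [Int.lt_floor_add_one (q * y - 1 : ℝ), Int.floor_le (q * z + 1 : ℝ)]
  · linarith [Int.floor_le (q * y + 1 : ℝ), Int.lt_floor_add_one (q * z - 1 : ℝ)]

/-! ### Integer points in a thin sector with a badly approximable slope -/

/-- The number of integers `m` with `s n < m ≤ (s + w) n`, summed over `1 ≤ n ≤ L`. -/
noncomputable def sectorSum (s w : ℝ) (L : ℕ) : ℤ :=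
  ∑ i ∈ Finset.range L, (⌊(s + w) * (i + 1 : ℕ)⌋ - ⌊s * (i + 1 : ℕ)⌋)

theorem sectorSum_mono {s w : ℝ} (hw : 0 ≤ w) : Monotone (sectorSum s w) := by
  refine monotone_nat_of_le_succ fun n => ?_
  rw [sectorSum, sectorSum, Finset.sum_range_succ]
  have : ⌊s * (n + 1 : ℕ)⌋ ≤ ⌊(s + w) * (n + 1 : ℕ)⌋ :=
    Int.floor_le_floor (by gcongr; linarith)
  linarith

theorem sectorSum_add_block {s w : ℝ} (hw : 0 ≤ w) {q : ℕ} (hq : 0 < q) {p : ℤ}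
    (hp : IsCoprime p (q : ℤ)) (hs : |s - p / q| ≤ 1 / (q * q : ℝ)) (n : ℕ) :
    (sectorSum s w n : ℝ) + q * (w * n) - 3 ≤ sectorSum s w (n + q) ∧
    (sectorSum s w (n + q) : ℝ) ≤ sectorSum s w n + q * (w * (n + q)) + 3 := by
  have hqr : (0 : ℝ) < q := by exact_mod_cast hq
  have hsplit : sectorSum s w (n + q) = sectorSum s w n + ∑ i ∈ Finset.range q,
      (⌊(s + w) * (n + i + 1 : ℕ)⌋ - ⌊s * (n + i + 1 : ℕ)⌋) := by
    rw [sectorSum, Finset.sum_range_add]; rfl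
  have h1 := (abs_le.1 (abs_sum_floor_block_sub_le hq hp hs (s * (n + 1) + w * n) (s * (n + 1)))).1
  have h2 := (abs_le.1 (abs_sum_floor_block_sub_le hq hp hs (s * (n + 1) + w * (n + q))
    (s * (n + 1)))).2
  -- Within a block the row width varies only between `w n` and `w (n + q)`; it is frozen at these
  -- two values.
  have c1 : ∑ i ∈ Finset.range q,
      (⌊s * (n + 1) + w * n + i * s⌋ - ⌊s * (n + 1) + i * s⌋) ≤
      ∑ i ∈ Finset.range q, (⌊(s + w) * (n + i + 1 : ℕ)⌋ - ⌊s * (n + i + 1 : ℕ)⌋) := by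
    refine Finset.sum_le_sum fun i _ => sub_le_sub (Int.floor_le_floor ?_) (le_of_eq ?_)
    · push_cast
      nlinarith [mul_nonneg hw (Nat.cast_nonneg (α := ℝ) i)]
    · congr 1; push_cast; ring
  have c2 : ∑ i ∈ Finset.range q, (⌊(s + w) * (n + i + 1 : ℕ)⌋ - ⌊s * (n + i + 1 : ℕ)⌋) ≤
      ∑ i ∈ Finset.range q,
        (⌊s * (n + 1) + w * (n + q) + i * s⌋ - ⌊s * (n + 1) + i * s⌋) := by
    refine Finset.sum_le_sum fun i hi => sub_le_sub (Int.floor_le_floor ?_) (le_of_eq ?_)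
    · push_cast
      have : (i : ℝ) + 1 ≤ q := by exact_mod_cast Finset.mem_range.1 hi
      nlinarith [mul_nonneg hw (sub_nonneg.2 this)]
    · congr 1; push_cast; ring
  have c1' := (Int.cast_le (R := ℝ)).2 c1
  have c2' := (Int.cast_le (R := ℝ)).2 c2
  rw [hsplit]
  rw [Int.cast_add]
  constructor
  · nlinarith
  · nlinarith

theorem sectorSum_mul_block {s w : ℝ} (hw : 0 ≤ w) {q : ℕ} (hq : 0 < q) {p : ℤ}
    (hp : IsCoprime p (q : ℤ)) (hs : |s - p / q| ≤ 1 / (q * q : ℝ)) (t : ℕ) :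
    w * q ^ 2 * (t * (t - 1)) / 2 - 3 * t ≤ sectorSum s w (q * t) ∧
    (sectorSum s w (q * t) : ℝ) ≤ w * q ^ 2 * (t * (t + 1)) / 2 + 3 * t := by
  induction t with
  | zero => simp [sectorSum]
  | succ t ih =>
    have h := sectorSum_add_block hw hq hp hs (q * t)
    rw [mul_add, mul_one]
    push_cast at h ⊢
    constructor
    · nlinarith [h.1, ih.1]
    · nlinarith [h.2, ih.2]

/-- `V` lies between two consecutive multiples of `q` and `sectorSum` is monotone. The terms in `w q
V` and `w q²` come from rounding to whole blocks, the others from the error 3 of each of the at most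
`V/q + 1` blocks. -/
theorem abs_sectorSum_sub_le {s w : ℝ} (hw : 0 ≤ w) {q : ℕ} (hq : 0 < q) {p : ℤ}
    (hp : IsCoprime p (q : ℤ)) (hs : |s - p / q| ≤ 1 / (q * q : ℝ)) {V : ℝ} (hV : 0 ≤ V) :
    |(sectorSum s w ⌊V⌋₊ : ℝ) - w * V ^ 2 / 2| ≤
      5 / 2 * (w * q * V) + w * q ^ 2 + 3 * V / q + 3 := by
  have hqr : (1 : ℝ) ≤ q := by exact_mod_cast hq
  set L := ⌊V⌋₊ with hL
  set t := L / q with ht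
  have hmod := Nat.div_add_mod L q
  have hlt := Nat.mod_lt L hq
  have hLV : (L : ℝ) ≤ V := Nat.floor_le hV
  have hVL : V < L + 1 := Nat.lt_floor_add_one V
  have ht1 : q * t ≤ L := by rw [ht]; omega
  have ht2 : L ≤ q * (t + 1) := by rw [mul_add, mul_one, ht]; omega
  have h1 := (sectorSum_mul_block hw hq hp hs t).1
  have h2 := (sectorSum_mul_block hw hq hp hs (t + 1)).2
  have m1 : (sectorSum s w (q * t) : ℝ) ≤ sectorSum s w L := by
    exact_mod_cast sectorSum_mono hw ht1
  have m2 : (sectorSum s w L : ℝ) ≤ sectorSum s w (q * (t + 1)) := by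
    exact_mod_cast sectorSum_mono hw ht2
  have r1 : (q : ℝ) * t ≤ V := le_trans (by exact_mod_cast ht1) hLV
  have r2 : V ≤ (q : ℝ) * t + q := by
    have : L + 1 ≤ q * t + q := by rw [ht]; omega
    have : (L : ℝ) + 1 ≤ q * t + q := by exact_mod_cast this
    linarith
  have ht0 : (0 : ℝ) ≤ t := Nat.cast_nonneg t
  have t3 : 3 * (t : ℝ) ≤ 3 * V / q := by
    rw [le_div_iff₀ (by linarith)]; linarith
  set x : ℝ := q * t with hx
  have hx0 : 0 ≤ x := by positivity
  push_cast at h2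
  rw [abs_le]
  have e1 : w * (q : ℝ) ^ 2 * (t * (t - 1)) / 2 = w * (x * (x - q)) / 2 := by rw [hx]; ring
  have e2 : w * (q : ℝ) ^ 2 * ((t + 1) * (t + 1 + 1)) / 2 = w * ((x + q) * (x + 2 * q)) / 2 := by
    rw [hx]; ring
  rw [e1] at h1
  rw [e2] at h2
  have p1 : V ^ 2 - 3 * q * V ≤ x * (x - q) := by
    rcases le_total V (2 * q) with h | h
    · rcases Nat.eq_zero_or_pos t with h0 | h0
      · have : x = 0 := by rw [hx, h0]; simp
        rw [this]; nlinarith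
      · have : (1 : ℝ) ≤ t := by exact_mod_cast h0
        have : 0 ≤ x - q := by rw [hx]; nlinarith
        nlinarith [mul_nonneg hx0 this]
    · nlinarith [mul_nonneg (show 0 ≤ x - (V - q) by linarith) (show 0 ≤ V - 2 * q by linarith),
        mul_nonneg (show 0 ≤ x - (V - q) by linarith) hx0]
  have p2 : (x + q) * (x + 2 * q) ≤ (V + q) * (V + 2 * q) := by gcongr
  have p1' := mul_le_mul_of_nonneg_left p1 hw
  have p2' := mul_le_mul_of_nonneg_left p2 hw
  have n1 : 0 ≤ w * q * V := by positivity
  have n2 : 0 ≤ w * (q : ℝ) ^ 2 := by positivity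
  have n3 : w * ((V + q) * (V + 2 * q)) = w * V ^ 2 + 3 * (w * q * V) + 2 * (w * q ^ 2) := by ring
  constructor
  · linarith
  · linarith

/-- A point `(n, m)` of the sector would satisfy `n (m - n s) ≤ w n² ≤ w V² < c`, against the
approximation hypothesis, which applies since `w ≤ ρ`. -/
theorem sectorSum_eq_zero {s w c ρ V : ℝ} (hw : 0 < w) (hV : 0 ≤ V) (hwρ : w ≤ ρ)
    (H : ∀ p q : ℤ, 0 < q → |p - q * s| ≤ ρ * q → c ≤ q * |p - q * s|) (hlt : w * V ^ 2 < c) :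
    sectorSum s w ⌊V⌋₊ = 0 := by
  refine Finset.sum_eq_zero fun i hi => ?_
  have hiV : ((i + 1 : ℕ) : ℝ) ≤ V :=
    le_trans (by exact_mod_cast Finset.mem_range.1 hi) (Nat.floor_le hV)
  have hi0 : (0 : ℝ) < (i + 1 : ℕ) := by positivity
  refine sub_eq_zero.2 (le_antisymm ?_ (Int.floor_le_floor (by gcongr; linarith)))
  rw [Int.le_floor]
  by_contra! hcon
  have hm := Int.floor_le ((s + w) * (i + 1 : ℕ))
  set m := ⌊(s + w) * (i + 1 : ℕ)⌋
  set n : ℝ := ((i + 1 : ℕ) : ℝ) with hn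
  have habs : |(m : ℝ) - n * s| = m - n * s := abs_of_pos (by linarith)
  have hle : (m : ℝ) - n * s ≤ w * n := by linarith
  have hn' : (((i + 1 : ℕ) : ℤ) : ℝ) = n := by rw [hn]; push_cast; rfl
  have h1 := H m ((i + 1 : ℕ) : ℤ) (by positivity) (by
    rw [hn', habs]; exact hle.trans (by gcongr))
  rw [hn', habs] at h1
  have h2 : n * (m - n * s) ≤ n * (w * n) := by gcongr
  have h3 : n * n ≤ V * V := by gcongr
  nlinarith

/-- If `w V² < c` the sector is empty and its area is itself within the error. Otherwise Dirichlet's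
theorem gives a denominator `q` with `q ≤ 2M/√w`, and bad approximability forces `q ≥ c/√w`. For
such `q` the errors `w q V`, `w q²` and `V/q` are all `O(V√w/c)`. Approximations need be controlled
only within `ρ q`, which is what the norm form provides. -/
theorem abs_sectorSum_sub_le_of_badlyApproximable {s w c ρ M V : ℝ} (hw : 0 < w) (hV : 0 ≤ V)
    (hc : 0 < c) (hc1 : c ≤ 1) (hM : 1 ≤ M) (hwM : √w ≤ M) (hσρ : √w ≤ M * ρ) (hwρ : w ≤ ρ)
    (H : ∀ p q : ℤ, 0 < q → |p - q * s| ≤ ρ * q → c ≤ q * |p - q * s|) :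
    |(sectorSum s w ⌊V⌋₊ : ℝ) - w * V ^ 2 / 2| ≤ 15 * M ^ 2 * (V * √w / c) := by
  set σ := √w with hσ
  have hσ0 : 0 < σ := Real.sqrt_pos.2 hw
  have hσ2 : σ * σ = w := Real.mul_self_sqrt hw.le
  have hρ : 0 < ρ := hw.trans_le hwρ
  rcases lt_or_ge (w * V ^ 2) c with hlt | hge
  · have hzero := sectorSum_eq_zero hw hV hwρ H hlt
    have hVσ : V * σ ≤ 1 := by
      have : (V * σ) ^ 2 ≤ 1 := by
        calc (V * σ) ^ 2 = w * V ^ 2 := by rw [← hσ2]; ring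
          _ ≤ 1 := by linarith
      nlinarith [mul_nonneg hV hσ0.le]
    have h4 : V * σ ≤ V * σ / c := le_div_self (by positivity) hc hc1
    rw [hzero, Int.cast_zero, zero_sub, abs_neg, abs_of_nonneg (by positivity)]
    have h5 : w * V ^ 2 / 2 = (V * σ) * (V * σ) / 2 := by rw [← hσ2]; ring
    have h6 : 0 ≤ V * σ := by positivity
    rw [h5]
    have h7 : (V * σ) * (V * σ) ≤ 1 * (V * σ / c) := mul_le_mul hVσ h4 h6 zero_le_one
    have h8 := mul_le_mul_of_nonneg_right (one_le_pow₀ (n := 2) hM) (h6.trans h4)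
    linarith
  -- The factor `M` serves twice: `M/σ ≥ 1`, so rounding up at most doubles it, and `σ ≤ M ρ` makes
  -- the Dirichlet error `1/(n + 1)` at most `ρ`.
  · set n := ⌈M / σ⌉₊ with hn
    have hMσ : 1 ≤ M / σ := (one_le_div hσ0).2 hwM
    have hn1 : M / σ ≤ n := Nat.le_ceil _
    have hn2 : (n : ℝ) ≤ 2 * (M / σ) := by
      have := Nat.ceil_lt_add_one (show 0 ≤ M / σ by positivity)
      linarith
    have hn0 : 0 < n := by
      have : (0 : ℝ) < n := by linarith
      exact_mod_cast this
    have hnr : (0 : ℝ) < n := by exact_mod_cast hn0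
    obtain ⟨r, hr, hrn⟩ := Real.exists_rat_abs_sub_le_and_den_le s hn0
    have hq0 : 0 < r.den := r.den_pos
    have hqr : (1 : ℝ) ≤ r.den := by exact_mod_cast hq0
    have hqn : (r.den : ℝ) ≤ n := by exact_mod_cast hrn
    have hcop : IsCoprime r.num (r.den : ℤ) := by
      rw [Int.isCoprime_iff_gcd_eq_one]
      exact r.reduced
    have hrr : (r : ℝ) = r.num / r.den := Rat.cast_def r
    rw [hrr] at hr
    have hs : |s - r.num / r.den| ≤ 1 / (r.den * r.den : ℝ) :=
      hr.trans (by gcongr; linarith)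
    have hmain := abs_sectorSum_sub_le hw.le hq0 hcop hs hV
    have happ : |(r.num : ℝ) - r.den * s| ≤ 1 / (n + 1) := by
      have : (r.num : ℝ) - r.den * s = -(r.den * (s - r.num / r.den)) := by field_simp; ring
      rw [this, abs_neg, abs_mul, abs_of_pos (by linarith : (0 : ℝ) < r.den)]
      calc (r.den : ℝ) * |s - r.num / r.den| ≤ r.den * (1 / ((n + 1) * r.den)) := by gcongr
        _ = 1 / (n + 1) := by field_simp
    have hnρ : 1 / (n + 1 : ℝ) ≤ ρ := by
      have h1 : M * ρ * (1 / σ) ≥ 1 := by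
        rw [mul_one_div, ge_iff_le, one_le_div hσ0]; exact hσρ
      rw [div_le_iff₀ (by positivity)]
      have h2 : ρ * (M / σ) ≤ ρ * n := by gcongr
      have h3 : ρ * (M / σ) = M * ρ * (1 / σ) := by ring
      nlinarith
    have hcq := H r.num r.den (by exact_mod_cast hq0) (by
      push_cast
      exact happ.trans (hnρ.trans (le_mul_of_one_le_right hρ.le hqr)))
    push_cast at hcq
    have hqlow : c * (n + 1) ≤ r.den := by
      have : c ≤ r.den * (1 / (n + 1 : ℝ)) := hcq.trans (by gcongr)
      rwa [mul_one_div, le_div_iff₀ (by positivity)] at this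
    have hqσ : c / σ ≤ r.den := by
      refine le_trans ?_ hqlow
      have h1 : 1 / σ ≤ M / σ := by gcongr
      have h2 : 1 / σ ≤ (n : ℝ) + 1 := by linarith
      calc c / σ = c * (1 / σ) := by ring
        _ ≤ _ := by gcongr
    have hqup : r.den * σ ≤ 2 * M := by
      have : (r.den : ℝ) ≤ 2 * (M / σ) := hqn.trans hn2
      calc r.den * σ ≤ 2 * (M / σ) * σ := by gcongr
        _ = 2 * M := by field_simp
    -- Outside the empty case `c² ≤ c ≤ w V²`, so the terms that do not grow with `V` are absorbed
    -- too.
    have hX : 1 ≤ V * σ / c := by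
      rw [one_le_div hc]
      have : c * c ≤ (V * σ) * (V * σ) := by
        calc c * c ≤ c := by nlinarith
          _ ≤ w * V ^ 2 := hge
          _ = _ := by rw [← hσ2]; ring
      exact (mul_self_le_mul_self_iff hc.le (by positivity)).2 this
    have hX' : V * σ ≤ V * σ / c := le_div_self (by positivity) hc hc1
    have t1 : w * r.den * V ≤ 2 * M * (V * σ / c) := by
      calc w * r.den * V = (r.den * σ) * (V * σ) := by rw [← hσ2]; ring
        _ ≤ 2 * M * (V * σ / c) := by gcongr
    have t2 : w * (r.den : ℝ) ^ 2 ≤ 4 * M ^ 2 * (V * σ / c) := by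
      calc w * (r.den : ℝ) ^ 2 = (r.den * σ) ^ 2 := by rw [← hσ2]; ring
        _ ≤ (2 * M) ^ 2 := by gcongr
        _ = 4 * M ^ 2 * 1 := by ring
        _ ≤ _ := by gcongr
    have t3 : 3 * V / r.den ≤ 3 * (V * σ / c) := by
      calc 3 * V / r.den ≤ 3 * V / (c / σ) := by gcongr
        _ = 3 * (V * σ / c) := by field_simp
    -- The four error terms contribute `5 + 4 + 3 + 3 = 15` multiples of `M² X`.
    set X := V * σ / c
    have hM2 : X ≤ M ^ 2 * X := 
      le_mul_of_one_le_left (by linarith) (one_le_pow₀ hM)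
    have hM1 : M * X ≤ M ^ 2 * X :=
      mul_le_mul_of_nonneg_right (le_self_pow₀ hM two_ne_zero) (by linarith)
    linarith

/-! ### Lattice points in sectors -/

/-- The integer points `(v, u)` with `0 < v ≤ V` and `s v < u ≤ (s + w) v`. -/
noncomputable def sector (s w V : ℝ) : Finset (ℤ × ℤ) :=
  ((Finset.Ioc 0 ⌊V⌋).sigma fun n => Finset.Ioc ⌊s * n⌋ ⌊(s + w) * n⌋).map
    (Equiv.sigmaEquivProd ℤ ℤ).toEmbedding

theorem mem_sector {s w V : ℝ} {p : ℤ × ℤ} :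
    p ∈ sector s w V ↔ 0 < p.1 ∧ (p.1 : ℝ) ≤ V ∧ s * p.1 < p.2 ∧ (p.2 : ℝ) ≤ (s + w) * p.1 := by
  simp [sector, Finset.mem_map_equiv, Int.le_floor, Int.floor_lt, and_assoc]

theorem card_sector {s w V : ℝ} (hw : 0 ≤ w) : ((sector s w V).card : ℤ) = sectorSum s w ⌊V⌋₊ := by
  rw [sector, Finset.card_map, Finset.card_sigma, sectorSum, Nat.cast_sum]
  refine Finset.sum_nbij' (fun n => (n - 1).toNat) (fun i => (i + 1 : ℕ)) ?_ ?_ ?_ ?_ ?_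
  · intro n hn
    simp only [Finset.mem_Ioc, Finset.mem_range] at hn ⊢
    have : ⌊V⌋.toNat = ⌊V⌋₊ := rfl
    omega
  · intro i hi
    simp only [Finset.mem_Ioc, Finset.mem_range] at hi ⊢
    have : ⌊V⌋.toNat = ⌊V⌋₊ := rfl
    omega
  · intro n hn
    simp only [Finset.mem_Ioc] at hn
    push_cast
    omega
  · intro i hi
    push_cast
    omega
  · intro n hn
    simp only [Finset.mem_Ioc] at hn
    have h1 : (((n - 1).toNat + 1 : ℕ) : ℝ) = (n : ℝ) := by
      have : (((n - 1).toNat + 1 : ℕ) : ℤ) = n := by push_cast; omega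
      exact_mod_cast congrArg (Int.cast (R := ℝ)) this
    have h2 : (0 : ℝ) < n := by exact_mod_cast hn.1
    rw [h1, Int.card_Ioc, Int.toNat_of_nonneg]
    exact sub_nonneg.2 (Int.floor_le_floor (by gcongr; linarith))

theorem natCast_dvd_mul_iff {f k : ℕ} (hk : 0 < k) (x : ℤ) :
    (f : ℤ) ∣ k * x ↔ ((f / f.gcd k : ℕ) : ℤ) ∣ x := by
  obtain ⟨g, F, K, hg, hc, rfl, rfl⟩ := Nat.exists_coprime' (m := f) (n := k)
    (Nat.gcd_pos_of_pos_right f hk)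
  rw [Nat.gcd_mul_right, hc.gcd_eq_one, one_mul, Nat.mul_div_cancel _ hg]
  push_cast
  have hg' : (g : ℤ) ≠ 0 := by exact_mod_cast hg.ne'
  rw [show (K * g * x : ℤ) = (K * x) * g by ring, Int.mul_dvd_mul_iff_right hg']
  exact ⟨(Nat.isCoprime_iff_coprime.2 hc).dvd_of_dvd_mul_left, fun h => h.mul_left _⟩

/-- The points `(v, u)` of a sector with `k ∣ v`, `k ∣ u`, `f₁ ∣ v`, `f₂ ∣ u`, `f₃ ∣ u - v`. -/
noncomputable def latticeSector (s w V : ℝ) (k f₁ f₂ f₃ : ℕ) : Finset (ℤ × ℤ) :=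
  {p ∈ sector s w V | ((k : ℤ) ∣ p.1 ∧ (k : ℤ) ∣ p.2) ∧
    (f₁ : ℤ) ∣ p.1 ∧ (f₂ : ℤ) ∣ p.2 ∧ (f₃ : ℤ) ∣ p.2 - p.1}

/-- A parametrisation of the lattice turns the count of lattice points in a sector into the count
of integer points in another sector. -/
theorem exists_card_latticeSector_eq (s : ℝ) {w : ℝ} (hw : 0 ≤ w) {k f₁ f₂ f₃ F₁ F₂ F₃ : ℕ}
    (hk : 0 < k) (hF₁ : F₁ = f₁ / f₁.gcd k) (hF₂ : F₂ = f₂ / f₂.gcd k) (hF₃ : F₃ = f₃ / f₃.gcd k)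
    (h₁ : 0 < F₁) (h₂ : 0 < F₂) (h₃ : 0 < F₃) (hc : F₂.Coprime F₃) :
    ∃ s' : ℝ, (∀ V : ℝ, ((latticeSector s w V k f₁ f₂ f₃).card : ℤ) =
        sectorSum s' (w * (F₁ / (F₂ * F₃))) ⌊V / (k * F₁)⌋₊) ∧
      ∀ p q : ℤ, ∃ u : ℤ, (F₂ : ℤ) ∣ u ∧ (F₃ : ℤ) ∣ u - F₁ * q ∧
        (u : ℝ) - s * (F₁ * q) = F₂ * F₃ * (p - q * s') := by
  have hkr : (0 : ℝ) < k := by exact_mod_cast hk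
  have r₁ : (0 : ℝ) < F₁ := by exact_mod_cast h₁
  have r₂ : (0 : ℝ) < F₂ := by exact_mod_cast h₂
  have r₃ : (0 : ℝ) < F₃ := by exact_mod_cast h₃
  have hc' := Nat.isCoprime_iff_coprime.2 hc
  -- By the Chinese remainder theorem the lattice consists of the points `v = F₁ n`, `u = F₂ (c n +
  -- F₃ m)`, where `F₂ c ≡ F₁` modulo `F₃`.
  obtain ⟨c, hcc⟩ : ∃ c : ℤ, (F₃ : ℤ) ∣ F₂ * c - F₁ := by
    obtain ⟨x, y, hxy⟩ := hc'
    exact ⟨x * F₁, -y * F₁, by linear_combination (F₁ : ℤ) * hxy⟩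
  have par : ∀ x n : ℤ, (F₃ : ℤ) ∣ F₂ * x - F₁ * n ↔ ∃ m, x = c * n + F₃ * m := by
    intro x n
    have e : F₂ * x - F₁ * n = F₂ * (x - c * n) + (F₂ * c - F₁) * n := by ring
    rw [e, dvd_add_left (hcc.mul_right n)]
    constructor
    · intro h
      obtain ⟨m, hm⟩ := hc'.symm.dvd_of_dvd_mul_left h
      exact ⟨m, by linarith⟩
    · rintro ⟨m, hm⟩
      exact Dvd.dvd.mul_left ⟨m, by linarith⟩ _
  -- In the coordinates `(n, m)` one has `u - s v = F₂ F₃ (m - n s')` for this `s'`.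
  refine ⟨(s * F₁ - F₂ * c) / (F₂ * F₃), fun V => ?_, fun p q => ⟨F₂ * (c * q + F₃ * p),
    dvd_mul_right _ _, (par _ _).2 ⟨p, rfl⟩, by push_cast; field_simp; ring⟩⟩
  rw [← card_sector (by positivity)]
  have bound : ∀ n m : ℤ, (s * ((k * F₁ * n : ℤ) : ℝ) < ((k * (F₂ * (c * n + F₃ * m)) : ℤ) : ℝ) ↔
      (s * F₁ - F₂ * c) / (F₂ * F₃) * n < m) ∧
      (((k * (F₂ * (c * n + F₃ * m)) : ℤ) : ℝ) ≤ (s + w) * ((k * F₁ * n : ℤ) : ℝ) ↔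
      (m : ℝ) ≤ ((s * F₁ - F₂ * c) / (F₂ * F₃) + w * (F₁ / (F₂ * F₃))) * n) := by
    intro n m
    push_cast
    have e1 : (s * F₁ - F₂ * c) / (F₂ * F₃) * n = (s * F₁ - F₂ * c) * n / (F₂ * F₃) := by ring
    have e2 : ((s * F₁ - F₂ * c) / (F₂ * F₃) + w * (F₁ / (F₂ * F₃))) * n =
      (s * F₁ - F₂ * c + w * F₁) * n / (F₂ * F₃) := by ring
    rw [e1, e2, div_lt_iff₀ (by positivity), le_div_iff₀ (by positivity)]
    constructor
    · have e3 : k * (F₂ * (c * n + F₃ * m)) - s * (k * F₁ * n) =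
          (k : ℝ) * (m * (F₂ * F₃) - (s * F₁ - F₂ * c) * n) := by ring
      rw [← sub_pos, e3, mul_pos_iff_of_pos_left hkr, sub_pos]
    · have e3 : (s + w) * (k * F₁ * n) - k * (F₂ * (c * n + F₃ * m)) =
          (k : ℝ) * ((s * F₁ - F₂ * c + w * F₁) * n - m * (F₂ * F₃)) := by ring
      rw [← sub_nonneg, e3, mul_nonneg_iff_of_pos_left hkr, sub_nonneg]
  have hn : ∀ n : ℤ, ((n : ℝ) ≤ V / (k * F₁) ↔ ((k * F₁ * n : ℤ) : ℝ) ≤ V) := by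
    intro n
    rw [le_div_iff₀ (by positivity)]; push_cast; rw [mul_comm]
  have hk' : (0 : ℤ) < k := by exact_mod_cast hk
  have hF : (0 : ℤ) < F₁ := by exact_mod_cast h₁
  congr 1
  symm
  refine Finset.card_bij (fun p _ => (k * F₁ * p.1, k * (F₂ * (c * p.1 + F₃ * p.2)))) ?_ ?_ ?_
  · rintro ⟨n, m⟩ h
    rw [mem_sector] at h
    obtain ⟨a1, a2, a3, a4⟩ := h
    rw [latticeSector, Finset.mem_filter, mem_sector]
    refine ⟨⟨by positivity, (hn n).1 a2, (bound n m).1.2 a3, (bound n m).2.2 a4⟩,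
      ⟨⟨F₁ * n, by ring⟩, dvd_mul_right _ _⟩, ?_, ?_, ?_⟩
    · rw [mul_assoc, natCast_dvd_mul_iff hk, ← hF₁]; exact dvd_mul_right _ _
    · rw [natCast_dvd_mul_iff hk, ← hF₂]; exact dvd_mul_right _ _
    · rw [mul_assoc, ← mul_sub, natCast_dvd_mul_iff hk, ← hF₃]
      exact (par _ _).2 ⟨m, rfl⟩
  · rintro ⟨n, m⟩ _ ⟨n', m'⟩ _ h
    simp only [Prod.mk.injEq] at h
    obtain ⟨e1, e2⟩ := h
    have e3 : n = n' := mul_left_cancel₀ (by positivity) e1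
    subst e3
    have e4 := mul_left_cancel₀ (by positivity) (mul_left_cancel₀ (by positivity) e2)
    have e5 : (F₃ : ℤ) * m = F₃ * m' := by linarith
    rw [mul_left_cancel₀ (by positivity) e5]
  · rintro ⟨v, u⟩ h
    rw [latticeSector, Finset.mem_filter, mem_sector] at h
    obtain ⟨⟨a1, a2, a3, a4⟩, ⟨⟨v, rfl⟩, ⟨u, rfl⟩⟩, a5, a6, a7⟩ := h
    simp only at a1 a2 a3 a4 a5 a6 a7
    rw [natCast_dvd_mul_iff hk, ← hF₁] at a5
    rw [natCast_dvd_mul_iff hk, ← hF₂] at a6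
    rw [← mul_sub, natCast_dvd_mul_iff hk, ← hF₃] at a7
    obtain ⟨n, rfl⟩ := a5
    obtain ⟨x, rfl⟩ := a6
    obtain ⟨m, rfl⟩ := (par _ _).1 a7
    rw [← mul_assoc (k : ℤ) (F₁ : ℤ) n] at a1 a2 a3 a4
    refine ⟨(n, m), ?_, by simp only [mul_assoc]⟩
    rw [mem_sector]
    exact ⟨pos_of_mul_pos_right a1 (by positivity), (hn n).2 a2, (bound n m).1.1 a3,
      (bound n m).2.1 a4⟩

/-- The norm form `a u² - b v²` is divisible by `F₁ F₂ F₃` on the lattice. -/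
theorem mul_mul_dvd_norm {a b u v F₁ F₂ F₃ : ℤ} (h₁₂ : IsCoprime F₁ F₂) (h₁₃ : IsCoprime F₁ F₃)
    (h₂₃ : IsCoprime F₂ F₃) (ha : F₁ ∣ a) (hb : F₂ ∣ b) (hab : F₃ ∣ b - a) (hv : F₁ ∣ v)
    (hu : F₂ ∣ u) (huv : F₃ ∣ u - v) : F₁ * F₂ * F₃ ∣ a * u ^ 2 - b * v ^ 2 := by
  refine IsCoprime.mul_dvd (h₁₃.mul_left h₂₃) (IsCoprime.mul_dvd h₁₂ ?_ ?_) ?_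
  · exact dvd_sub (ha.mul_right _) ((hv.trans (dvd_pow_self v two_ne_zero)).mul_left _)
  · exact dvd_sub ((hu.trans (dvd_pow_self u two_ne_zero)).mul_left _) (hb.mul_right _)
  · have : a * u ^ 2 - b * v ^ 2 = (u - v) * (a * (u + v)) - (b - a) * v ^ 2 := by ring
    rw [this]
    exact dvd_sub (huv.mul_right _) (hab.mul_right _)

/-- Quadratic irrational slopes are badly approximable along the lattice. -/
theorem one_div_le_mul_abs_of_norm_dvd {a b F₁ F₂ F₃ : ℕ} {s s' M : ℝ} {p q u : ℤ} (ha : 0 < a)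
    (hs : 0 < s) (hs2 : a * s ^ 2 = b)
    (hirr : ∀ u v : ℤ, v ≠ 0 → (a : ℤ) * u ^ 2 - b * v ^ 2 ≠ 0) (hM : 0 < M)
    (p₁ : 0 < F₁) (p₂ : 0 < F₂) (p₃ : 0 < F₃) (hq : 0 < q)
    (hdvd : (F₁ * F₂ * F₃ : ℤ) ∣ a * u ^ 2 - b * (F₁ * q) ^ 2)
    (hreal : (u : ℝ) - s * (F₁ * q) = F₂ * F₃ * (p - q * s'))
    (hpq : |p - q * s'| ≤ M * (F₁ / (F₂ * F₃)) * q) :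
    1 / (a * (2 * s + M)) ≤ q * |p - q * s'| := by
  have har : (0 : ℝ) < a := by exact_mod_cast ha
  have q₁ : (0 : ℝ) < F₁ := by exact_mod_cast p₁
  have q₂ : (0 : ℝ) < F₂ := by exact_mod_cast p₂
  have q₃ : (0 : ℝ) < F₃ := by exact_mod_cast p₃
  have hqr : (0 : ℝ) < q := by exact_mod_cast hq
  have hne := hirr u (F₁ * q) (by positivity)
  -- The form is a nonzero multiple of `F₁ F₂ F₃`, hence at least that large. It factors as `a (u -
  -- s v)(u + s v)` with `v = F₁ q`, where the first bracket is `F₂ F₃ (p - q s')` and the second is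
  -- at most `(2s + M) F₁ q`. The index cancels, so the bound does not depend on the lattice.
  have hle := Int.le_of_dvd (abs_pos.2 hne) ((dvd_abs _ _).2 hdvd)
  have hle' : (F₁ : ℝ) * F₂ * F₃ ≤ |a * (u : ℝ) ^ 2 - b * (F₁ * q) ^ 2| := by exact_mod_cast hle
  have hfac : a * (u : ℝ) ^ 2 - b * (F₁ * q) ^ 2 =
      a * ((u - s * (F₁ * q)) * (u + s * (F₁ * q))) := by rw [← hs2]; ring
  rw [hfac, hreal, abs_mul, abs_mul, abs_mul, abs_of_pos har,
    abs_of_pos (by positivity : (0 : ℝ) < F₂ * F₃)] at hle'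
  have hsum : |(u : ℝ) + s * (F₁ * q)| ≤ (2 * s + M) * (F₁ * q) := by
    have e4 : (u : ℝ) + s * (F₁ * q) = F₂ * F₃ * (p - q * s') + 2 * s * (F₁ * q) := by
      rw [← hreal]; ring
    rw [e4]
    refine (abs_add_le _ _).trans ?_
    rw [abs_mul, abs_of_pos (by positivity : (0 : ℝ) < F₂ * F₃),
      abs_of_pos (by positivity : 0 < 2 * s * (F₁ * q))]
    have : (F₂ : ℝ) * F₃ * |p - q * s'| ≤ F₂ * F₃ * (M * (F₁ / (F₂ * F₃)) * q) := by gcongr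
    have e5 : (F₂ : ℝ) * F₃ * (M * (F₁ / (F₂ * F₃)) * q) = M * (F₁ * q) := by field_simp
    linarith
  have h6 : (F₁ : ℝ) * F₂ * F₃ * 1 ≤
      F₁ * F₂ * F₃ * (a * (2 * s + M) * (q * |p - q * s'|)) := by
    calc (F₁ : ℝ) * F₂ * F₃ * 1 ≤ a * (F₂ * F₃ * |p - q * s'| * |u + s * (F₁ * q)|) := by
          rw [mul_one]; exact hle'
      _ ≤ a * (F₂ * F₃ * |p - q * s'| * ((2 * s + M) * (F₁ * q))) := by gcongr
      _ = _ := by ring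
  have h7 := le_of_mul_le_mul_left h6 (by positivity)
  rw [div_le_iff₀ (by positivity)]
  linarith

/-- The sector count is applied in lattice coordinates with width `w ρ`, `ρ = F₁/(F₂ F₃)`, and
approximation constant `1/(a(2s + M))`. The error is uniform in the `fᵢ` and decays like `1/k`,
because the rows of the rescaled sector end at `V/(k F₁)`. -/
theorem abs_card_latticeSector_sub_le {a b k f₁ f₂ f₃ F₁ F₂ F₃ : ℕ} {s w V M : ℝ} (ha : 0 < a)
    (hab : a < b) (hs : 0 < s) (hs2 : a * s ^ 2 = b)
    (hirr : ∀ u v : ℤ, v ≠ 0 → (a : ℤ) * u ^ 2 - b * v ^ 2 ≠ 0) (hk : 0 < k)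
    (hF₁ : F₁ = f₁ / f₁.gcd k) (hF₂ : F₂ = f₂ / f₂.gcd k) (hF₃ : F₃ = f₃ / f₃.gcd k)
    (hf₁ : f₁ ∣ a) (hf₂ : f₂ ∣ b) (hf₃ : f₃ ∣ b - a) (c₁₂ : f₁.Coprime f₂) (c₁₃ : f₁.Coprime f₃)
    (c₂₃ : f₂.Coprime f₃) (hM : 1 ≤ M) (hw : 0 < w) (hwb : w * b ^ 2 ≤ M) (hV : 0 ≤ V) :
    |((latticeSector s w V k f₁ f₂ f₃).card : ℝ) - w * V ^ 2 / 2 / (k ^ 2 * (F₁ * F₂ * F₃))| ≤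
      15 * M ^ 2 * (a * (2 * s + M)) * (V * √w) / k := by
  have d₁ : F₁ ∣ f₁ := hF₁ ▸ Nat.div_dvd_of_dvd (Nat.gcd_dvd_left _ _)
  have d₂ : F₂ ∣ f₂ := hF₂ ▸ Nat.div_dvd_of_dvd (Nat.gcd_dvd_left _ _)
  have d₃ : F₃ ∣ f₃ := hF₃ ▸ Nat.div_dvd_of_dvd (Nat.gcd_dvd_left _ _)
  have p₁ : 0 < F₁ := Nat.pos_of_dvd_of_pos (d₁.trans hf₁) ha
  have p₂ : 0 < F₂ := Nat.pos_of_dvd_of_pos (d₂.trans hf₂) (by omega)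
  have p₃ : 0 < F₃ := Nat.pos_of_dvd_of_pos (d₃.trans hf₃) (by omega)
  have l₁ : F₁ ≤ b := (Nat.le_of_dvd ha (d₁.trans hf₁)).trans hab.le
  have l₂ : F₂ ≤ b := Nat.le_of_dvd (by omega) (d₂.trans hf₂)
  have l₃ : F₃ ≤ b := (Nat.le_of_dvd (by omega) (d₃.trans hf₃)).trans (Nat.sub_le _ _)
  have i₁₂ := Nat.isCoprime_iff_coprime.2 (c₁₂.of_dvd d₁ d₂)
  have i₁₃ := Nat.isCoprime_iff_coprime.2 (c₁₃.of_dvd d₁ d₃)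
  have i₂₃ := Nat.isCoprime_iff_coprime.2 (c₂₃.of_dvd d₂ d₃)
  have e₁ : (F₁ : ℤ) ∣ a := by exact_mod_cast d₁.trans hf₁
  have e₂ : (F₂ : ℤ) ∣ b := by exact_mod_cast d₂.trans hf₂
  have e₃ : (F₃ : ℤ) ∣ (b : ℤ) - a := by
    rw [← Nat.cast_sub hab.le]; exact_mod_cast d₃.trans hf₃
  have har : (1 : ℝ) ≤ a := by exact_mod_cast ha
  have hbr : (1 : ℝ) ≤ b := har.trans (by exact_mod_cast hab.le)
  have q₁ : (1 : ℝ) ≤ F₁ := by exact_mod_cast p₁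
  have q₂ : (1 : ℝ) ≤ F₂ := by exact_mod_cast p₂
  have q₃ : (1 : ℝ) ≤ F₃ := by exact_mod_cast p₃
  have r₁ : (F₁ : ℝ) ≤ b := by exact_mod_cast l₁
  have r₂ : (F₂ : ℝ) ≤ b := by exact_mod_cast l₂
  have r₃ : (F₃ : ℝ) ≤ b := by exact_mod_cast l₃
  have hkr : (1 : ℝ) ≤ k := by exact_mod_cast hk
  obtain ⟨s', hcard, hpt⟩ := exists_card_latticeSector_eq s hw.le hk hF₁ hF₂ hF₃ p₁ p₂ p₃
    (c₂₃.of_dvd d₂ d₃)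
  set ρ : ℝ := F₁ / (F₂ * F₃) with hρ
  have hρ0 : 0 < ρ := by positivity
  -- Since `ρ ≥ 1/b²`, the hypothesis `w b² ≤ M` keeps the sector within the range where the norm
  -- form controls approximations.
  have hρb : w ≤ M * ρ := by
    have h1 : 1 ≤ ρ * b ^ 2 := by
      rw [hρ, div_mul_eq_mul_div, one_le_div (by positivity)]
      nlinarith [mul_le_mul r₂ r₃ (by positivity) (by positivity)]
    have h2 : w * b ^ 2 ≤ (M * ρ) * b ^ 2 := by nlinarith
    exact le_of_mul_le_mul_right h2 (by positivity)
  have hwM : w ≤ M := by nlinarith [one_le_pow₀ (n := 2) hbr]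
  have hρF : ρ ≤ F₁ := div_le_self (by positivity) (by nlinarith)
  have hMM : M ≤ M ^ 2 := le_self_pow₀ hM two_ne_zero
  set c : ℝ := 1 / (a * (2 * s + M)) with hc
  have hD : 1 ≤ a * (2 * s + M) := by nlinarith
  have hc0 : 0 < c := by positivity
  have hc1 : c ≤ 1 := by rw [hc, div_le_one (by positivity)]; exact hD
  have key := abs_sectorSum_sub_le_of_badlyApproximable (s := s') (w := w * ρ) (c := c)
    (ρ := M * ρ) (M := M) (V := V / (k * F₁)) (by positivity) (by positivity) hc0 hc1 hM ?_ ?_ ?_ ?_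
  · have hcard' : ((latticeSector s w V k f₁ f₂ f₃).card : ℝ)
        = (sectorSum s' (w * ρ) ⌊V / (k * F₁)⌋₊ : ℝ) := by exact_mod_cast hcard V
    rw [hcard']
    have e : w * V ^ 2 / 2 / (k ^ 2 * (F₁ * F₂ * F₃)) = w * ρ * (V / (k * F₁)) ^ 2 / 2 := by
      rw [hρ]; field_simp
    rw [e]
    refine key.trans ?_
    have h3 : V / (k * F₁) * √(w * ρ) ≤ V * √w / k := by
      rw [Real.sqrt_mul hw.le]
      have : √ρ ≤ F₁ := by
        rw [Real.sqrt_le_left (by positivity)]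
        exact hρF.trans (le_self_pow₀ q₁ two_ne_zero)
      calc V / (k * F₁) * (√w * √ρ) ≤ V / (k * F₁) * (√w * F₁) := by gcongr
        _ = V * √w / k := by field_simp
    calc 15 * M ^ 2 * (V / (k * F₁) * √(w * ρ) / c) ≤ 15 * M ^ 2 * (V * √w / k / c) := by gcongr
      _ = _ := by rw [hc]; field_simp
  · rw [Real.sqrt_le_left (by positivity)]
    have : w * ρ ≤ w * b ^ 2 := by gcongr; nlinarith
    linarith
  · rw [Real.sqrt_le_left (by positivity)]
    have : w * ρ ≤ M * ρ * ρ := by gcongr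
    have : M * ρ * ρ ≤ M ^ 2 * (M ^ 2) * (ρ * ρ) := by
      rw [mul_assoc]; gcongr; nlinarith
    nlinarith
  · gcongr
  · intro p q hq hpq
    obtain ⟨u, hu2, hu3, hreal⟩ := hpt p q
    exact one_div_le_mul_abs_of_norm_dvd ha hs hs2 hirr (by linarith) p₁ p₂ p₃ hq
      (mul_mul_dvd_norm i₁₂ i₁₃ i₂₃ e₁ e₂ e₃ (dvd_mul_right (F₁ : ℤ) q) hu2 hu3) hreal hpq

/-- Dividing a point by `k` leaves `(v, u)` with `k v ≤ V` and `1 ≤ a u² - b v² ≤ a(2s + M) w v²`,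
which bounds `k`. The Möbius sum over `k` is therefore finite, of length about `V √(w a(2s + M))`.
-/
theorem latticeSector_eq_empty {a b k f₁ f₂ f₃ : ℕ} {s w V M : ℝ} (ha : 0 < a) (hs : 0 < s)
    (hs2 : a * s ^ 2 = b) (hirr : ∀ u v : ℤ, v ≠ 0 → (a : ℤ) * u ^ 2 - b * v ^ 2 ≠ 0) (hk : 0 < k)
    (hw : 0 < w) (hwM : w ≤ M) (hkV : a * (2 * s + M) * (w * V ^ 2) < k ^ 2) :
    latticeSector s w V k f₁ f₂ f₃ = ∅ := by
  refine Finset.eq_empty_of_forall_notMem ?_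
  rintro ⟨v, u⟩ h
  rw [latticeSector, Finset.mem_filter, mem_sector] at h
  obtain ⟨⟨a1, a2, a3, a4⟩, ⟨⟨v, rfl⟩, ⟨u, rfl⟩⟩, -⟩ := h
  simp only at a1 a2 a3 a4
  have hk' : (0 : ℤ) < k := by exact_mod_cast hk
  have hkr : (0 : ℝ) < k := by exact_mod_cast hk
  have har : (0 : ℝ) < a := by exact_mod_cast ha
  have hv : 0 < v := pos_of_mul_pos_right a1 hk'.le
  have hvr : (0 : ℝ) < v := by exact_mod_cast hv
  have h1 : (1 : ℝ) ≤ |a * (u : ℝ) ^ 2 - b * v ^ 2| := by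
    exact_mod_cast Int.one_le_abs (hirr u v hv.ne')
  push_cast at a2 a3 a4
  have b3 : s * v < u := by
    by_contra! hcon
    nlinarith [mul_le_mul_of_nonneg_left hcon hkr.le]
  have b4 : (u : ℝ) ≤ (s + w) * v := by
    have : (k : ℝ) * u ≤ k * ((s + w) * v) := by linarith
    exact le_of_mul_le_mul_left this hkr
  have hfac : a * (u : ℝ) ^ 2 - b * v ^ 2 = a * ((u - s * v) * (u + s * v)) := by
    rw [← hs2]; ring
  have hsv : 0 < s * v := by positivity
  have hpos : 0 < (u - s * v) * (u + s * v) := mul_pos (by linarith) (by linarith)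
  rw [hfac, abs_of_pos (by positivity)] at h1
  have h2 : (u - s * v) * (u + s * v) ≤ (w * v) * ((2 * s + M) * v) := by
    apply mul_le_mul <;> nlinarith
  have h3 : (k : ℝ) ^ 2 ≤ a * (2 * s + M) * (w * (k * v) ^ 2) := by
    have := mul_le_mul_of_nonneg_left (h1.trans (mul_le_mul_of_nonneg_left h2 har.le))
      (sq_nonneg (k : ℝ))
    calc (k : ℝ) ^ 2 = k ^ 2 * 1 := by ring
      _ ≤ _ := this
      _ = _ := by ring
  have h4 : a * (2 * s + M) * (w * (k * v) ^ 2) ≤ a * (2 * s + M) * (w * V ^ 2) := by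
    have : 0 ≤ M := hw.le.trans hwM
    gcongr
  linarith

/-! ### The Möbius series, its Euler product, and the function `Psi` -/

open ArithmeticFunction in
theorem tsum_moebius_div_sq : ∑' k : ℕ, (moebius k : ℝ) / (k : ℝ) ^ 2 = 6 / Real.pi ^ 2 := by
  have h := LSeries_zeta_mul_Lseries_moebius (s := 2) (by norm_num)
  rw [LSeries_zeta_eq_riemannZeta (by norm_num), riemannZeta_two] at h
  have h2 : LSeries (fun n => ((moebius n : ℤ) : ℂ)) 2 =
      ((∑' k : ℕ, (moebius k : ℝ) / (k : ℝ) ^ 2 : ℝ) : ℂ) := by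
    rw [LSeries, Complex.ofReal_tsum]
    refine tsum_congr fun k => ?_
    rcases eq_or_ne k 0 with rfl | hk
    · simp
    · rw [LSeries.term_of_ne_zero hk]
      push_cast
      norm_cast
  rw [h2] at h
  have h3 : (Real.pi ^ 2 / 6) * ∑' k : ℕ, (moebius k : ℝ) / (k : ℝ) ^ 2 = 1 := by exact_mod_cast h
  have hpi := Real.pi_pos
  field_simp at h3 ⊢
  linarith

/-- The arithmetic function `k ↦ μ(k) gcd(f, k) / k²`. -/
noncomputable def moebiusGcd (f : ℕ) : ArithmeticFunction ℝ :=
  ⟨fun k => (ArithmeticFunction.moebius k : ℝ) * (f.gcd k) / (k : ℝ) ^ 2, by simp⟩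

theorem moebiusGcd_apply (f k : ℕ) :
    moebiusGcd f k = (ArithmeticFunction.moebius k : ℝ) * (f.gcd k) / (k : ℝ) ^ 2 := rfl

theorem isMultiplicative_moebiusGcd (f : ℕ) : (moebiusGcd f).IsMultiplicative := by
  refine ⟨by simp [moebiusGcd_apply], fun {m n} hmn => ?_⟩
  rw [moebiusGcd_apply, moebiusGcd_apply, moebiusGcd_apply, hmn.gcd_mul f,
    ArithmeticFunction.isMultiplicative_moebius.map_mul_of_coprime hmn]
  push_cast
  rw [div_mul_div_comm]
  ring

theorem abs_moebius_le_one (k : ℕ) : |(ArithmeticFunction.moebius k : ℝ)| ≤ 1 := by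
  exact_mod_cast ArithmeticFunction.abs_moebius_le_one

theorem abs_moebiusGcd_le {f : ℕ} (hf : 0 < f) (k : ℕ) :
    |moebiusGcd f k| ≤ f * ((k : ℝ) ^ 2)⁻¹ := by
  rw [moebiusGcd_apply, div_eq_mul_inv, abs_mul, abs_mul, Nat.abs_cast,
    abs_of_nonneg (by positivity : (0 : ℝ) ≤ ((k : ℝ) ^ 2)⁻¹)]
  have h1 : ((f.gcd k : ℕ) : ℝ) ≤ f := by exact_mod_cast Nat.gcd_le_left k hf
  have h2 := abs_moebius_le_one k
  gcongr
  calc _ ≤ 1 * (f : ℝ) := by gcongr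
    _ = f := one_mul _

theorem summable_norm_moebiusGcd {f : ℕ} (hf : 0 < f) : Summable fun k => ‖moebiusGcd f k‖ := by
  refine Summable.of_nonneg_of_le (fun _ => norm_nonneg _) (fun k => ?_)
    ((Real.summable_nat_pow_inv.2 one_lt_two).mul_left (f : ℝ))
  rw [Real.norm_eq_abs]
  exact abs_moebiusGcd_le hf k

theorem hasProd_moebiusGcd {f : ℕ} (hf : 0 < f) :
    HasProd (fun p : Nat.Primes => 1 - (f.gcd p : ℝ) / (p : ℝ) ^ 2) (∑' k, moebiusGcd f k) := by
  have h := (isMultiplicative_moebiusGcd f).eulerProduct_hasProd (summable_norm_moebiusGcd hf)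
  have key : (fun p : Nat.Primes => ∑' e, moebiusGcd f ((p : ℕ) ^ e)) =
      fun p : Nat.Primes => 1 - (f.gcd p : ℝ) / (p : ℝ) ^ 2 := by
    funext p
    have hp : Nat.Prime (p : ℕ) := p.2
    rw [tsum_eq_sum (s := Finset.range 2)]
    · simp [Finset.sum_range_succ, moebiusGcd_apply, ArithmeticFunction.moebius_apply_prime hp]
      ring
    · intro e he
      have he2 : 1 < e := by simpa using he
      rw [moebiusGcd_apply, ArithmeticFunction.moebius_apply_prime_pow hp (by omega),
        if_neg (by omega)]
      simp
  rw [key] at h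
  exact h

theorem hasProd_Psi₁ {f : ℕ} (hf : 0 < f) :
    HasProd (fun p : Nat.Primes => if (p : ℕ) ∣ f then (1 + 1 / (p : ℝ))⁻¹ else 1) (Psi₁ f) := by
  have h : Psi₁ f = ∏ p ∈ (Finset.subtype Nat.Prime f.primeFactors : Finset Nat.Primes),
      if (p : ℕ) ∣ f then (1 + 1 / (p : ℝ))⁻¹ else 1 := by
    rw [Psi₁, Finset.prod_subtype_of_mem (fun p : ℕ => if p ∣ f then (1 + 1 / (p : ℝ))⁻¹ else 1)
      (fun p hp => Nat.prime_of_mem_primeFactors hp)]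
    exact Finset.prod_congr rfl fun p hp => (if_pos (Nat.dvd_of_mem_primeFactors hp)).symm
  rw [h]
  refine hasProd_prod_of_ne_finset_one fun p hp => if_neg fun hd => hp ?_
  exact Finset.mem_subtype.2 (Nat.mem_primeFactors.2 ⟨p.2, hd, hf.ne'⟩)

/-- The Euler factor at `p` is `1 - 1/p` if `p ∣ f` and `1 - 1/p²` otherwise. Dividing by the
product for `f = 1`, which is `1/ζ(2)`, leaves `(1 + 1/p)⁻¹` for each `p ∣ f`. -/
theorem tsum_moebiusGcd {f : ℕ} (hf : 0 < f) :
    ∑' k, moebiusGcd f k = 6 / Real.pi ^ 2 * Psi₁ f := by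
  have h1 := (hasProd_moebiusGcd one_pos).mul (hasProd_Psi₁ hf)
  have h2 : ∑' k, moebiusGcd 1 k = 6 / Real.pi ^ 2 := by
    rw [← tsum_moebius_div_sq]
    exact tsum_congr fun k => by simp [moebiusGcd_apply]
  rw [h2] at h1
  refine (hasProd_moebiusGcd hf).unique ?_
  convert h1 using 2 with p
  have hp : (1 : ℝ) < (p : ℕ) := by exact_mod_cast p.2.one_lt
  split_ifs with hd
  · rw [Nat.gcd_eq_right hd]
    simp only [Nat.gcd_one_left, Nat.cast_one]
    have : (p : ℝ) + 1 ≠ 0 := by positivity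
    field_simp
    ring
  · rw [((Nat.Prime.coprime_iff_not_dvd p.2).2 hd).symm.gcd_eq_one]
    simp

theorem hasSum_moebiusGcd {f : ℕ} (hf : 0 < f) :
    HasSum (moebiusGcd f) (6 / Real.pi ^ 2 * Psi₁ f) := by
  rw [← tsum_moebiusGcd hf]
  exact (summable_norm_moebiusGcd hf).of_norm.hasSum

theorem Psi₁_mul {m n : ℕ} (h : m.Coprime n) : Psi₁ (m * n) = Psi₁ m * Psi₁ n := by
  rw [Psi₁, h.primeFactors_mul, Finset.prod_union h.disjoint_primeFactors]; rfl

theorem Psi₁_nonneg (n : ℕ) : 0 ≤ Psi₁ n := Finset.prod_nonneg fun _ _ => by positivity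

theorem Psi₁_le_one (n : ℕ) : Psi₁ n ≤ 1 :=
  Finset.prod_le_one (fun _ _ => by positivity) fun p _ =>
    inv_le_one_of_one_le₀ (by linarith [show (0 : ℝ) ≤ 1 / p by positivity])

open ArithmeticFunction in
/-- `Ψ` is multiplicative. -/
theorem Psi_mul {m n : ℕ} (h : m.Coprime n) : Psi (m * n) = Psi m * Psi n := by
  -- `Psi₁ 0` is an empty product, equal to 1, while an arithmetic function must vanish at 0. `Psi`
  -- is then built from multiplicative functions by Dirichlet convolution and pointwise product.
  let P : ArithmeticFunction ℝ := ⟨fun n => if n = 0 then 0 else Psi₁ n, by simp⟩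
  let I : ArithmeticFunction ℝ := ⟨fun n => (n : ℝ)⁻¹, by simp⟩
  have hP : P.IsMultiplicative := by
    refine IsMultiplicative.iff_ne_zero.2 ⟨by simp [P, Psi₁], fun {m n} hm hn hmn => ?_⟩
    simp [P, hm, hn, Psi₁_mul hmn]
  have hI : I.IsMultiplicative :=
    IsMultiplicative.iff_ne_zero.2 ⟨by simp [I], fun {m n} hm hn hmn => by simp [I, mul_comm]⟩
  have hμ : ((moebius : ArithmeticFunction ℤ) : ArithmeticFunction ℝ).IsMultiplicative :=
    isMultiplicative_moebius.intCast
  have hζ : ((zeta : ArithmeticFunction ℕ) : ArithmeticFunction ℝ).IsMultiplicative :=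
    isMultiplicative_zeta.natCast
  have hall := (hP.pmul ((hμ.pmul hI).mul hζ)).mul hζ
  have hPsi : ∀ n, Psi n = ((P.pmul ((((moebius : ArithmeticFunction ℤ) :
      ArithmeticFunction ℝ).pmul I) * ((zeta : ArithmeticFunction ℕ) : ArithmeticFunction ℝ))) *
      ((zeta : ArithmeticFunction ℕ) : ArithmeticFunction ℝ)) n := by
    intro n
    rw [coe_mul_zeta_apply, Psi]
    refine Finset.sum_congr rfl fun d hd => ?_
    rw [pmul_apply, coe_mul_zeta_apply]
    have : d ≠ 0 := (Nat.pos_of_mem_divisors hd).ne'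
    have hI' : ∀ n : ℕ, I n = (n : ℝ)⁻¹ := fun _ => rfl
    have hP' : P d = Psi₁ d := if_neg this
    simp only [pmul_apply, hI', hP', div_eq_mul_inv, intCoe_apply]
  rw [hPsi, hPsi, hPsi, hall.map_mul_of_coprime h]

theorem card_divisors_le_two_mul_sqrt (n : ℕ) : n.divisors.card ≤ 2 * n.sqrt := by
  have hsub : n.divisors ⊆ Finset.Icc 1 n.sqrt ∪ (Finset.Icc 1 n.sqrt).image (n / ·) := by
    intro d hd
    have hd0 := Nat.pos_of_mem_divisors hd
    obtain ⟨hdn, hn⟩ := Nat.mem_divisors.1 hd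
    obtain ⟨e, rfl⟩ := hdn
    have he0 : 0 < e := Nat.pos_of_ne_zero fun h => hn (by rw [h, mul_zero])
    rw [Finset.mem_union, Finset.mem_image]
    rcases le_total d e with h | h
    · exact Or.inl (Finset.mem_Icc.2 ⟨hd0, Nat.le_sqrt.2 (Nat.mul_le_mul_left d h)⟩)
    · exact Or.inr ⟨e, Finset.mem_Icc.2 ⟨he0, Nat.le_sqrt.2 (Nat.mul_le_mul_right e h)⟩,
        Nat.mul_div_cancel _ he0⟩
  calc n.divisors.card ≤ _ := Finset.card_le_card hsub
    _ ≤ _ := Finset.card_union_le _ _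
    _ ≤ n.sqrt + n.sqrt := by
      gcongr
      · simp
      · exact Finset.card_image_le.trans (by simp)
    _ = _ := by ring

/-- A crude bound for the number of pairs `(f, d)` in the inversion over the gcds; with `n ≤ b³` it
costs a factor `b³`, which the final error can afford. -/
theorem card_divisors_sq_le (n : ℕ) : (n.divisors.card : ℝ) ^ 2 ≤ 4 * n := by
  have h1 := card_divisors_le_two_mul_sqrt n
  have h2 := Nat.sqrt_le' n
  have : n.divisors.card ^ 2 ≤ 4 * n := by nlinarith
  exact_mod_cast this

/-! ### Coprime points in sectors -/

/-- The points `(v, u)` of a sector with coprime coordinates and `f₁ ∣ v`, `f₂ ∣ u`,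
`f₃ ∣ u - v`. -/
noncomputable def coprimeSector (s w V : ℝ) (f₁ f₂ f₃ : ℕ) : Finset (ℤ × ℤ) :=
  {p ∈ sector s w V | Int.gcd p.1 p.2 = 1 ∧
    (f₁ : ℤ) ∣ p.1 ∧ (f₂ : ℤ) ∣ p.2 ∧ (f₃ : ℤ) ∣ p.2 - p.1}

theorem sum_divisors_moebius {R : Type*} [Ring R] (n : ℕ) :
    ∑ d ∈ n.divisors, (ArithmeticFunction.moebius d : R) = if n = 1 then 1 else 0 := by
  have h := congrArg (fun f : ArithmeticFunction ℤ => f n)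
    ArithmeticFunction.moebius_mul_coe_zeta
  simp only [ArithmeticFunction.coe_mul_zeta_apply, ArithmeticFunction.one_apply] at h
  have h' := congrArg (Int.cast (R := R)) h
  push_cast at h'
  exact h'

theorem card_coprimeSector {s w V : ℝ} {f₁ f₂ f₃ K : ℕ}
    (hK : ∀ k : ℕ, K < k → latticeSector s w V k f₁ f₂ f₃ = ∅) :
    ((coprimeSector s w V f₁ f₂ f₃).card : ℝ) = ∑ k ∈ Finset.Icc 1 K,
      (ArithmeticFunction.moebius k : ℝ) * (latticeSector s w V k f₁ f₂ f₃).card := by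
  set A : Finset (ℤ × ℤ) := {p ∈ sector s w V |
    (f₁ : ℤ) ∣ p.1 ∧ (f₂ : ℤ) ∣ p.2 ∧ (f₃ : ℤ) ∣ p.2 - p.1} with hA
  have h1 : coprimeSector s w V f₁ f₂ f₃ = {p ∈ A | Int.gcd p.1 p.2 = 1} := by
    rw [hA, Finset.filter_filter, coprimeSector]
    exact Finset.filter_congr fun p _ => and_comm
  have h2 : ∀ k : ℕ, latticeSector s w V k f₁ f₂ f₃ =
      {p ∈ A | (k : ℤ) ∣ p.1 ∧ (k : ℤ) ∣ p.2} := by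
    intro k
    rw [hA, Finset.filter_filter, latticeSector]
    exact Finset.filter_congr fun p _ => and_comm
  have h3 : ∀ p ∈ A, (if Int.gcd p.1 p.2 = 1 then (1 : ℝ) else 0) =
      ∑ k ∈ Finset.Icc 1 K, (ArithmeticFunction.moebius k : ℝ) *
        (if (k : ℤ) ∣ p.1 ∧ (k : ℤ) ∣ p.2 then 1 else 0) := by
    intro p hp
    have hp0 : p.1 ≠ 0 := (mem_sector.1 (Finset.mem_filter.1 hp).1).1.ne'
    rw [← sum_divisors_moebius]
    simp only [mul_ite, mul_one, mul_zero]
    rw [← Finset.sum_filter]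
    refine Finset.sum_congr ?_ fun _ _ => rfl
    ext k
    rw [Nat.mem_divisors, Finset.mem_filter, Finset.mem_Icc, Int.natCast_dvd, Int.natCast_dvd,
      ← Nat.dvd_gcd_iff, ← Int.gcd_eq_natAbs]
    constructor
    · rintro ⟨h, h0⟩
      refine ⟨⟨Nat.pos_of_ne_zero ?_, ?_⟩, h⟩
      · rintro rfl
        exact hp0 (Int.gcd_eq_zero_iff.1 (Nat.eq_zero_of_zero_dvd h)).1
      · by_contra! hk
        have : p ∈ latticeSector s w V k f₁ f₂ f₃ := by
          rw [h2, Finset.mem_filter, Int.natCast_dvd, Int.natCast_dvd, ← Nat.dvd_gcd_iff]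
          exact ⟨hp, h⟩
        rw [hK k hk] at this
        exact absurd this (Finset.notMem_empty p)
    · rintro ⟨-, h⟩
      exact ⟨h, fun h0 => hp0 (Int.gcd_eq_zero_iff.1 h0).1⟩
  rw [h1, Finset.card_filter, Nat.cast_sum]
  push_cast
  rw [Finset.sum_congr rfl h3, Finset.sum_comm]
  refine Finset.sum_congr rfl fun k _ => ?_
  rw [← Finset.mul_sum, h2, Finset.card_filter]
  push_cast
  rfl

/-- The lattice attached to `k` thus has covolume `k² f / gcd(f, k)` with `f = f₁ f₂ f₃`, which
explains the coefficients of `moebiusGcd`. -/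
theorem mul_mul_div_gcd {f₁ f₂ f₃ k : ℕ} (hk : 0 < k) (c₁₂ : f₁.Coprime f₂) (c₁₃ : f₁.Coprime f₃)
    (c₂₃ : f₂.Coprime f₃) :
    (((f₁ / f₁.gcd k : ℕ) : ℝ) * ((f₂ / f₂.gcd k : ℕ) : ℝ) * ((f₃ / f₃.gcd k : ℕ) : ℝ)) =
      ((f₁ * f₂ * f₃ : ℕ) : ℝ) / ((f₁ * f₂ * f₃).gcd k : ℝ) := by
  have h : ((f₁ * f₂ * f₃).gcd k) = f₁.gcd k * f₂.gcd k * f₃.gcd k := by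
    rw [Nat.gcd_comm, (c₁₃.mul_left c₂₃).gcd_mul, c₁₂.gcd_mul, Nat.gcd_comm k, Nat.gcd_comm k,
      Nat.gcd_comm k]
  rw [h]
  have e : ∀ f : ℕ, ((f / f.gcd k : ℕ) : ℝ) = f / (f.gcd k : ℝ) := fun f =>
    Nat.cast_div (Nat.gcd_dvd_left f k)
      (by exact_mod_cast (Nat.gcd_pos_of_pos_right f hk).ne')
  rw [e, e, e]
  push_cast
  rw [div_mul_div_comm, div_mul_div_comm]

theorem abs_hasSum_sub_sum_Icc_le {g : ℕ → ℝ} {S c : ℝ} (hg : HasSum g S) (hg0 : g 0 = 0)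
    (hgc : ∀ k, |g k| ≤ c * ((k : ℝ) ^ 2)⁻¹) (hc : 0 ≤ c) (K : ℕ) :
    |S - ∑ k ∈ Finset.Icc 1 K, g k| ≤ c * (2 / (K + 1)) := by
  have ht := (hg.tendsto_sum_nat.sub_const (∑ k ∈ Finset.Icc 1 K, g k)).abs
  refine le_of_tendsto ht (Filter.eventually_atTop.2 ⟨K + 1, fun n hn => ?_⟩)
  have h1 : ∑ k ∈ Finset.range n, g k - ∑ k ∈ Finset.Icc 1 K, g k =
      ∑ k ∈ Finset.Ioo K n, g k := by
    have h2 : ∑ k ∈ Finset.Icc 1 K, g k = ∑ k ∈ Finset.range (K + 1), g k := by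
      rw [Finset.range_eq_Ico, Finset.sum_eq_sum_Ico_succ_bot (by omega), hg0, zero_add]
      rfl
    rw [h2, ← Finset.sum_Ico_eq_sub _ hn]
    rfl
  rw [h1]
  calc |∑ k ∈ Finset.Ioo K n, g k| ≤ ∑ k ∈ Finset.Ioo K n, |g k| := Finset.abs_sum_le_sum_abs _ _
    _ ≤ ∑ k ∈ Finset.Ioo K n, c * ((k : ℝ) ^ 2)⁻¹ := Finset.sum_le_sum fun k _ => hgc k
    _ = c * ∑ k ∈ Finset.Ioo K n, ((k : ℝ) ^ 2)⁻¹ := (Finset.mul_sum ..).symm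
    _ ≤ c * (2 / (K + 1)) := by gcongr; exact sum_Ioo_inv_sq_le K n

theorem sum_Icc_inv_le (K : ℕ) : ∑ k ∈ Finset.Icc 1 K, (1 : ℝ) / k ≤ 1 + Real.log K := by
  have h := harmonic_le_one_add_log K
  rw [harmonic_eq_sum_Icc] at h
  push_cast at h
  simpa using h

/-- The errors `O(1/k)`, summed over the range of `k` where the lattice sector can be nonempty, give
the logarithm. Completing the Möbius series costs `w V²/(K + 1)`, at most `V √w`, since `V √w ≤ K +
1`. -/
theorem abs_card_coprimeSector_sub_le {a b f₁ f₂ f₃ : ℕ} {s w V M X : ℝ} (ha : 0 < a)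
    (hab : a < b) (hs : 0 < s) (hs2 : a * s ^ 2 = b)
    (hirr : ∀ u v : ℤ, v ≠ 0 → (a : ℤ) * u ^ 2 - b * v ^ 2 ≠ 0)
    (hf₁ : f₁ ∣ a) (hf₂ : f₂ ∣ b) (hf₃ : f₃ ∣ b - a) (c₁₂ : f₁.Coprime f₂) (c₁₃ : f₁.Coprime f₃)
    (c₂₃ : f₂.Coprime f₃) (hM : 1 ≤ M) (hw : 0 < w) (hwb : w * b ^ 2 ≤ M) (hV : 0 ≤ V)
    (hX1 : 1 ≤ X) (hX : V * √(w * (a * (2 * s + M))) ≤ X) :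
    |((coprimeSector s w V f₁ f₂ f₃).card : ℝ) -
        3 / Real.pi ^ 2 * (w * V ^ 2) * (Psi₁ (f₁ * f₂ * f₃) / (f₁ * f₂ * f₃ : ℕ))| ≤
      15 * M ^ 2 * (a * (2 * s + M)) * (V * √w) * (2 + Real.log X) := by
  set D := (a : ℝ) * (2 * s + M) with hD
  set f := f₁ * f₂ * f₃ with hf
  have hf0 : 0 < f := by
    have h1 := Nat.pos_of_dvd_of_pos hf₁ ha
    have h2 := Nat.pos_of_dvd_of_pos hf₂ (by omega)
    have h3 := Nat.pos_of_dvd_of_pos hf₃ (by omega)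
    positivity
  have hfr : (1 : ℝ) ≤ f := by exact_mod_cast hf0
  have har : (1 : ℝ) ≤ a := by exact_mod_cast ha
  have hbr : (1 : ℝ) ≤ b := har.trans (by exact_mod_cast hab.le)
  have hD1 : 1 ≤ D := by nlinarith
  have hwM : w ≤ M := by nlinarith [one_le_pow₀ (n := 2) hbr]
  set K := ⌊V * √(w * D)⌋₊ with hK
  have hK1 : V * √(w * D) < K + 1 := Nat.lt_floor_add_one _
  have hempty : ∀ k : ℕ, K < k → latticeSector s w V k f₁ f₂ f₃ = ∅ := by
    intro k hk
    refine latticeSector_eq_empty ha hs hs2 hirr (by omega) hw hwM ?_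
    have h1 : V * √(w * D) < k := hK1.trans_le (by exact_mod_cast hk)
    calc D * (w * V ^ 2) = (V * √(w * D)) ^ 2 := by
          rw [mul_pow, Real.sq_sqrt (by positivity)]; ring
      _ < (k : ℝ) ^ 2 := by gcongr
  set E := 15 * M ^ 2 * D * (V * √w) with hE
  have hE0 : 0 ≤ E := by positivity
  have hsum := (hasSum_moebiusGcd hf0).mul_left (w * V ^ 2 / 2 / f)
  have hgoal : 3 / Real.pi ^ 2 * (w * V ^ 2) * (Psi₁ f / (f : ℕ)) =
      w * V ^ 2 / 2 / f * (6 / Real.pi ^ 2 * Psi₁ f) := by ring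
  have htail := abs_hasSum_sub_sum_Icc_le (c := w * V ^ 2 / 2) hsum (by simp) (fun k => by
    rw [abs_mul, abs_of_nonneg (by positivity : 0 ≤ w * V ^ 2 / 2 / f)]
    calc w * V ^ 2 / 2 / f * |moebiusGcd f k| ≤ w * V ^ 2 / 2 / f * (f * ((k : ℝ) ^ 2)⁻¹) := by
          gcongr; exact abs_moebiusGcd_le hf0 k
      _ = _ := by field_simp) (by positivity) K
  have htail' : w * V ^ 2 / 2 * (2 / (K + 1)) ≤ E := by
    have h1 : V * √w ≤ K + 1 := by
      refine le_trans ?_ hK1.le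
      gcongr
      nlinarith
    have h2 : w * V ^ 2 / 2 * (2 / (K + 1)) = (V * √w) * (V * √w) / (K + 1) := by
      field_simp
      rw [Real.sq_sqrt hw.le, mul_comm]
    rw [h2, div_le_iff₀ (by positivity)]
    calc (V * √w) * (V * √w) ≤ (V * √w) * (K + 1) := by gcongr
      _ ≤ E * (K + 1) := by
        gcongr
        exact le_mul_of_one_le_left (by positivity)
          (by nlinarith [one_le_pow₀ (n := 2) hM, mul_le_mul (one_le_pow₀ (n := 2) hM) hD1 zero_le_one (by positivity)])
  have hterm : ∀ k ∈ Finset.Icc 1 K,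
      |(ArithmeticFunction.moebius k : ℝ) * (latticeSector s w V k f₁ f₂ f₃).card -
        w * V ^ 2 / 2 / f * moebiusGcd f k| ≤ E * (1 / k) := by
    intro k hk
    have hk0 : 0 < k := (Finset.mem_Icc.1 hk).1
    have h := abs_card_latticeSector_sub_le (M := M) (V := V) ha hab hs hs2 hirr hk0 rfl rfl rfl
      hf₁ hf₂ hf₃ c₁₂ c₁₃ c₂₃ hM hw hwb hV
    rw [mul_mul_div_gcd hk0 c₁₂ c₁₃ c₂₃] at h
    have hg0 : (0 : ℝ) < (f.gcd k : ℕ) := by exact_mod_cast Nat.gcd_pos_of_pos_right f hk0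
    have e : (ArithmeticFunction.moebius k : ℝ) * (latticeSector s w V k f₁ f₂ f₃).card -
        w * V ^ 2 / 2 / f * moebiusGcd f k = (ArithmeticFunction.moebius k : ℝ) *
        ((latticeSector s w V k f₁ f₂ f₃).card -
          w * V ^ 2 / 2 / (k ^ 2 * ((f : ℕ) / (f.gcd k : ℝ)))) := by
      rw [moebiusGcd_apply]
      have : (k : ℝ) ≠ 0 := by positivity
      field_simp
    rw [e, abs_mul]
    calc _ ≤ 1 * (E / k) := mul_le_mul (abs_moebius_le_one k) h (abs_nonneg _) zero_le_one
      _ = E * (1 / k) := by ring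
  rw [hgoal, card_coprimeSector hempty]
  -- `K = 0` may occur; then `Real.log 0 = 0`.
  have hlog : Real.log K ≤ Real.log X := by
    rcases Nat.eq_zero_or_pos K with h0 | h0
    · rw [h0]; simpa using Real.log_nonneg hX1
    · exact Real.log_le_log (by exact_mod_cast h0) ((Nat.floor_le (by positivity)).trans hX)
  have hmain : |∑ k ∈ Finset.Icc 1 K, ((ArithmeticFunction.moebius k : ℝ) *
      (latticeSector s w V k f₁ f₂ f₃).card) - ∑ k ∈ Finset.Icc 1 K,
        w * V ^ 2 / 2 / f * moebiusGcd f k| ≤ E * (1 + Real.log X) := by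
    rw [← Finset.sum_sub_distrib]
    calc _ ≤ ∑ k ∈ Finset.Icc 1 K, _ := Finset.abs_sum_le_sum_abs _ _
      _ ≤ ∑ k ∈ Finset.Icc 1 K, E * (1 / (k : ℝ)) := Finset.sum_le_sum hterm
      _ = E * ∑ k ∈ Finset.Icc 1 K, (1 / (k : ℝ)) := (Finset.mul_sum ..).symm
      _ ≤ E * (1 + Real.log X) := by gcongr; exact (sum_Icc_inv_le K).trans (by linarith)
  rw [abs_le] at hmain htail ⊢
  constructor <;> nlinarith

/-! ### Inversion over the gcds in the height -/

/-- Möbius inversion on the divisors of `n`: it trades the condition `g = d` for the conditions `f ∣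
g`, which define lattices. -/
theorem sum_moebius_div_of_dvd {d g n : ℕ} (hn : n ≠ 0) (hg : g ∣ n) (hd : 0 < d) :
    ∑ f ∈ n.divisors with d ∣ f, (ArithmeticFunction.moebius (f / d) : ℝ) *
      (if f ∣ g then 1 else 0) = if g = d then 1 else 0 := by
  have hg0 : 0 < g := Nat.pos_of_dvd_of_pos hg (Nat.pos_of_ne_zero hn)
  simp only [mul_ite, mul_one, mul_zero]
  rw [← Finset.sum_filter, Finset.filter_filter]
  by_cases hdg : d ∣ g
  · obtain ⟨e, rfl⟩ := hdg
    have he : 0 < e := Nat.pos_of_mul_pos_left hg0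
    have h1 : (d * e = d) ↔ e = 1 := by
      constructor
      · intro h; exact Nat.eq_of_mul_eq_mul_left hd (by omega)
      · rintro rfl; simp
    simp only [h1]
    rw [← sum_divisors_moebius]
    refine Finset.sum_nbij' (· / d) (d * ·) ?_ ?_ ?_ ?_ ?_
    · intro f hf
      obtain ⟨-, ⟨c, rfl⟩, h⟩ := Finset.mem_filter.1 hf
      rw [Nat.mul_div_cancel_left _ hd]
      exact Nat.mem_divisors.2 ⟨Nat.dvd_of_mul_dvd_mul_left hd h, he.ne'⟩
    · intro c hc
      have h := Nat.mul_dvd_mul_left d (Nat.dvd_of_mem_divisors hc)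
      exact Finset.mem_filter.2 ⟨Nat.mem_divisors.2 ⟨h.trans hg, hn⟩, dvd_mul_right _ _, h⟩
    · intro f hf
      exact Nat.mul_div_cancel' (Finset.mem_filter.1 hf).2.1
    · intro c _
      exact Nat.mul_div_cancel_left _ hd
    · intro f _
      rfl
  · rw [if_neg (fun h : g = d => hdg (h ▸ dvd_rfl))]
    refine Finset.sum_eq_zero fun f hf => ?_
    obtain ⟨-, h1, h2⟩ := Finset.mem_filter.1 hf
    exact absurd (h1.trans h2) hdg

/-- The product of greatest common divisors by which the height drops at `(v, u)`. -/
def gcdProd (a b : ℕ) (p : ℤ × ℤ) : ℕ :=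
  Int.gcd p.1 a * Int.gcd p.2 b * Int.gcd (p.2 - p.1) ((b - a : ℕ) : ℤ)

theorem gcdProd_dvd (a b : ℕ) (p : ℤ × ℤ) : gcdProd a b p ∣ a * b * (b - a) := by
  have h : ∀ (x : ℤ) (c : ℕ), Int.gcd x c ∣ c := fun x c => by
    exact_mod_cast Int.gcd_dvd_right x (c : ℤ)
  exact mul_dvd_mul (mul_dvd_mul (h _ _) (h _ _)) (h _ _)

/-- `a`, `b` and `b - a` are pairwise coprime, so each `fᵢ` can divide only its own gcd. -/
theorem dvd_gcdProd_iff {a b f₁ f₂ f₃ : ℕ} (hab : a.Coprime b) (hlt : a ≤ b)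
    (hf₁ : f₁ ∣ a) (hf₂ : f₂ ∣ b) (hf₃ : f₃ ∣ b - a) (p : ℤ × ℤ) :
    f₁ * f₂ * f₃ ∣ gcdProd a b p ↔ (f₁ : ℤ) ∣ p.1 ∧ (f₂ : ℤ) ∣ p.2 ∧ (f₃ : ℤ) ∣ p.2 - p.1 := by
  have c₁₃ : a.Coprime (b - a) := (Nat.coprime_sub_self_right hlt).2 hab
  have c₂₃ : b.Coprime (b - a) := by
    rw [Nat.coprime_comm]
    exact (Nat.coprime_self_sub_left hlt).2 hab
  have h : ∀ (x : ℤ) (c : ℕ), Int.gcd x c ∣ c := fun x c => by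
    exact_mod_cast Int.gcd_dvd_right x (c : ℤ)
  have h' : ∀ (x : ℤ) (c f : ℕ), f ∣ c → (f ∣ Int.gcd x c ↔ (f : ℤ) ∣ x) := fun x c f hf => by
    rw [Int.gcd_eq_natAbs, Nat.dvd_gcd_iff, Int.natCast_dvd, Int.natAbs_natCast]
    exact and_iff_left hf
  rw [← h' _ _ _ hf₁, ← h' _ _ _ hf₂, ← h' _ _ _ hf₃, gcdProd]
  constructor
  · intro hd
    refine ⟨?_, ?_, ?_⟩
    · have h1 := ((dvd_mul_right f₁ f₂).mul_right f₃).trans hd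
      exact ((hab.of_dvd hf₁ (h _ _)).dvd_of_dvd_mul_right
        ((c₁₃.of_dvd hf₁ (h _ _)).dvd_of_dvd_mul_right h1))
    · have h1 := ((dvd_mul_left f₂ f₁).mul_right f₃).trans hd
      exact ((hab.symm.of_dvd hf₂ (h _ _)).dvd_of_dvd_mul_left
        ((c₂₃.of_dvd hf₂ (h _ _)).dvd_of_dvd_mul_right h1))
    · have h1 := (dvd_mul_left f₃ (f₁ * f₂)).trans hd
      exact ((c₁₃.mul_left c₂₃).symm.of_dvd hf₃
        (mul_dvd_mul (h _ _) (h _ _))).dvd_of_dvd_mul_left h1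
  · rintro ⟨d₁, d₂, d₃⟩
    exact mul_dvd_mul (mul_dvd_mul d₁ d₂) d₃

/-- The coprime points `(v, u)` of slope in `(s, s + w]` with `v² ≤ Y gcdProd a b (v, u)`. -/
noncomputable def heightSector (a b : ℕ) (s w Y : ℝ) : Finset (ℤ × ℤ) :=
  {p ∈ sector s w √(Y * (a * b * (b - a) : ℕ)) |
    Int.gcd p.1 p.2 = 1 ∧ (p.1 : ℝ) ^ 2 ≤ Y * gcdProd a b p}

/-- The truncation in `heightSector` only ensures finiteness: `gcdProd` divides `ab(b - a)`, so the
last condition implies it. -/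
theorem mem_heightSector {a b : ℕ} (ha : 0 < a) (hab : a < b) {s w Y : ℝ} (hY : 0 ≤ Y)
    {p : ℤ × ℤ} :
    p ∈ heightSector a b s w Y ↔ 0 < p.1 ∧ Int.gcd p.1 p.2 = 1 ∧ s * p.1 < p.2 ∧
      (p.2 : ℝ) ≤ (s + w) * p.1 ∧ (p.1 : ℝ) ^ 2 ≤ Y * gcdProd a b p := by
  have hn : 0 < a * b * (b - a) := by
    have : 0 < b := by omega
    have : 0 < b - a := by omega
    positivity
  rw [heightSector, Finset.mem_filter, mem_sector]
  constructor
  · rintro ⟨⟨h1, h2, h3, h4⟩, h5, h6⟩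
    exact ⟨h1, h5, h3, h4, h6⟩
  · rintro ⟨h1, h5, h3, h4, h6⟩
    refine ⟨⟨h1, Real.le_sqrt_of_sq_le (h6.trans ?_), h3, h4⟩, h5, h6⟩
    gcongr
    exact Nat.le_of_dvd hn (gcdProd_dvd a b p)

/-- Where `gcdProd` equals `d` the height condition is `v ≤ √(Y d)`, a plain sector. The condition
`gcdProd = d` is then inverted, each `f ∣ ab(b - a)` splitting into its gcds with `a`, `b` and `b -
a`. -/
theorem card_heightSector {a b : ℕ} (ha : 0 < a) (hab : a < b) (hcop : a.Coprime b) {s w Y : ℝ}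
    (hY : 0 ≤ Y) :
    ((heightSector a b s w Y).card : ℝ) = ∑ f ∈ (a * b * (b - a)).divisors, ∑ d ∈ f.divisors,
      (ArithmeticFunction.moebius (f / d) : ℝ) *
        (coprimeSector s w √(Y * d) (f.gcd a) (f.gcd b) (f.gcd (b - a))).card := by
  set n := a * b * (b - a) with hn
  have hn0 : n ≠ 0 := by
    have : 0 < b := by omega
    have : 0 < b - a := by omega
    positivity
  have c₁₃ : a.Coprime (b - a) := (Nat.coprime_sub_self_right hab.le).2 hcop
  have c₂₃ : b.Coprime (b - a) := by
    rw [Nat.coprime_comm]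
    exact (Nat.coprime_self_sub_left hab.le).2 hcop
  have h1 : (heightSector a b s w Y).card = ∑ d ∈ n.divisors,
      {p ∈ heightSector a b s w Y | gcdProd a b p = d}.card :=
    Finset.card_eq_sum_card_fiberwise fun p _ =>
      Nat.mem_divisors.2 ⟨gcdProd_dvd a b p, hn0⟩
  have h2 : ∀ d ∈ n.divisors,
      (({p ∈ heightSector a b s w Y | gcdProd a b p = d}.card : ℕ) : ℝ) =
      ∑ f ∈ n.divisors with d ∣ f, (ArithmeticFunction.moebius (f / d) : ℝ) *
        (coprimeSector s w √(Y * d) (f.gcd a) (f.gcd b) (f.gcd (b - a))).card := by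
    intro d hd
    set A : Finset (ℤ × ℤ) := {p ∈ sector s w √(Y * d) | Int.gcd p.1 p.2 = 1} with hA
    have e1 : ({p ∈ heightSector a b s w Y | gcdProd a b p = d} : Finset (ℤ × ℤ)) =
        {p ∈ A | gcdProd a b p = d} := by
      ext p
      rw [Finset.mem_filter, mem_heightSector ha hab hY, Finset.mem_filter, hA, Finset.mem_filter,
        mem_sector]
      constructor
      · rintro ⟨⟨g1, g2, g3, g4, g5⟩, rfl⟩
        exact ⟨⟨⟨g1, Real.le_sqrt_of_sq_le g5, g3, g4⟩, g2⟩, rfl⟩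
      · rintro ⟨⟨⟨g1, g5, g3, g4⟩, g2⟩, rfl⟩
        have : (0 : ℝ) < p.1 := by exact_mod_cast g1
        exact ⟨⟨g1, g2, g3, g4, (Real.le_sqrt this.le (by positivity)).1 g5⟩, rfl⟩
    have e2 : ∀ f ∈ n.divisors, coprimeSector s w √(Y * d) (f.gcd a) (f.gcd b) (f.gcd (b - a)) =
        {p ∈ A | f ∣ gcdProd a b p} := by
      intro f hf
      have hff : f = f.gcd a * f.gcd b * f.gcd (b - a) := by
        rw [← hcop.gcd_mul, ← (c₁₃.mul_left c₂₃).gcd_mul]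
        exact (Nat.gcd_eq_left (Nat.dvd_of_mem_divisors hf)).symm
      ext p
      rw [coprimeSector, hA, Finset.filter_filter, Finset.mem_filter, Finset.mem_filter]
      conv_rhs => rw [hff, dvd_gcdProd_iff hcop hab.le (Nat.gcd_dvd_right _ _)
        (Nat.gcd_dvd_right _ _) (Nat.gcd_dvd_right _ _)]
    rw [e1, Finset.card_filter]
    push_cast
    rw [Finset.sum_congr rfl fun p _ => (sum_moebius_div_of_dvd hn0 (gcdProd_dvd a b p)
      (Nat.pos_of_mem_divisors hd)).symm, Finset.sum_comm]
    refine Finset.sum_congr rfl fun f hf => ?_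
    rw [← Finset.mul_sum, e2 f (Finset.mem_filter.1 hf).1, Finset.card_filter]
    push_cast
    rfl
  rw [h1]
  push_cast
  rw [Finset.sum_congr rfl h2]
  refine Finset.sum_comm' fun d f => ?_
  rw [Finset.mem_filter, Nat.mem_divisors, Nat.mem_divisors, Nat.mem_divisors]
  constructor
  · rintro ⟨-, ⟨g1, g2⟩, g3⟩
    exact ⟨⟨g3, fun h => hn0 (Nat.eq_zero_of_zero_dvd (h ▸ g1))⟩, g1, g2⟩
  · rintro ⟨⟨g1, -⟩, g2, g3⟩
    exact ⟨⟨g1.trans g2, g3⟩, ⟨g2, g3⟩, g1⟩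

/-- The origin of the inner sum of `Psi`: the sector attached to `d` has area proportional to `d`,
and enters with weight `μ(f/d)`. -/
theorem sum_divisors_moebius_div_mul (f : ℕ) :
    ∑ d ∈ f.divisors, (ArithmeticFunction.moebius (f / d) : ℝ) * (d / f) =
      ∑ e ∈ f.divisors, (ArithmeticFunction.moebius e : ℝ) / e := by
  rw [← Nat.sum_div_divisors f (fun e => (ArithmeticFunction.moebius e : ℝ) / e)]
  refine Finset.sum_congr rfl fun d hd => ?_
  have hf : (f : ℝ) ≠ 0 := by exact_mod_cast (Nat.mem_divisors.1 hd).2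
  have hd0 : (d : ℝ) ≠ 0 := by exact_mod_cast (Nat.pos_of_mem_divisors hd).ne'
  rw [Nat.cast_div (Nat.dvd_of_mem_divisors hd) hd0]
  field_simp

/-- The main terms sum to `Psi (ab(b - a))`, which factors by multiplicativity. Each pair `(f, d)`
has an error at most that of the largest sector, `d = ab(b - a)`. -/
theorem abs_card_heightSector_sub_le {a b : ℕ} {s w Y M X : ℝ} (ha : 0 < a)
    (hab : a < b) (hcop : a.Coprime b) (hs : 0 < s) (hs2 : a * s ^ 2 = b)
    (hirr : ∀ u v : ℤ, v ≠ 0 → (a : ℤ) * u ^ 2 - b * v ^ 2 ≠ 0)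
    (hM : 1 ≤ M) (hw : 0 < w) (hwb : w * b ^ 2 ≤ M) (hY : 0 ≤ Y) (hX1 : 1 ≤ X)
    (hX : √(Y * (a * b * (b - a) : ℕ)) * √(w * (a * (2 * s + M))) ≤ X) :
    |((heightSector a b s w Y).card : ℝ) -
        3 / Real.pi ^ 2 * (w * Y) * (Psi b * Psi a * Psi (b - a))| ≤
      4 * (a * b * (b - a) : ℕ) * (15 * M ^ 2 * (a * (2 * s + M)) *
        (√(Y * (a * b * (b - a) : ℕ)) * √w) * (2 + Real.log X)) := by
  rw [card_heightSector ha hab hcop hY]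
  set n := a * b * (b - a) with hn
  have hn0 : n ≠ 0 := by
    have : 0 < b := by omega
    have : 0 < b - a := by omega
    positivity
  have c₁₃ : a.Coprime (b - a) := (Nat.coprime_sub_self_right hab.le).2 hcop
  have c₂₃ : b.Coprime (b - a) := by
    rw [Nat.coprime_comm]
    exact (Nat.coprime_self_sub_left hab.le).2 hcop
  have hPsi : Psi b * Psi a * Psi (b - a) = Psi n := by
    rw [hn, Psi_mul (c₁₃.mul_left c₂₃), Psi_mul hcop, mul_comm (Psi b)]
  have hmain : 3 / Real.pi ^ 2 * (w * Y) * Psi n = ∑ f ∈ n.divisors, ∑ d ∈ f.divisors,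
      (ArithmeticFunction.moebius (f / d) : ℝ) *
        (3 / Real.pi ^ 2 * (w * (Y * d)) * (Psi₁ f / f)) := by
    rw [Psi, Finset.mul_sum]
    refine Finset.sum_congr rfl fun f _ => ?_
    rw [← sum_divisors_moebius_div_mul, Finset.mul_sum, Finset.mul_sum]
    exact Finset.sum_congr rfl fun d _ => by ring
  rw [hPsi, hmain, ← Finset.sum_sub_distrib]
  set E := 15 * M ^ 2 * (a * (2 * s + M)) * (√(Y * n) * √w) * (2 + Real.log X) with hE
  have hE0 : 0 ≤ E := by
    have := Real.log_nonneg hX1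
    positivity
  have hterm : ∀ f ∈ n.divisors, ∀ d ∈ f.divisors,
      |(ArithmeticFunction.moebius (f / d) : ℝ) *
        (coprimeSector s w √(Y * d) (f.gcd a) (f.gcd b) (f.gcd (b - a))).card -
       (ArithmeticFunction.moebius (f / d) : ℝ) *
        (3 / Real.pi ^ 2 * (w * (Y * d)) * (Psi₁ f / f))| ≤ E := by
    intro f hf d hd
    have hdn : (d : ℝ) ≤ n := by
      exact_mod_cast Nat.le_of_dvd (Nat.pos_of_ne_zero hn0)
        ((Nat.dvd_of_mem_divisors hd).trans (Nat.dvd_of_mem_divisors hf))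
    have hff : f.gcd a * f.gcd b * f.gcd (b - a) = f := by
      rw [← hcop.gcd_mul, ← (c₁₃.mul_left c₂₃).gcd_mul]
      exact Nat.gcd_eq_left (Nat.dvd_of_mem_divisors hf)
    have hVle : √(Y * d) ≤ √(Y * n) := Real.sqrt_le_sqrt (by gcongr)
    have h := abs_card_coprimeSector_sub_le (f₁ := f.gcd a) (f₂ := f.gcd b) (f₃ := f.gcd (b - a))
      (V := √(Y * d)) ha hab hs hs2 hirr (Nat.gcd_dvd_right _ _) (Nat.gcd_dvd_right _ _)
      (Nat.gcd_dvd_right _ _) (hcop.of_dvd (Nat.gcd_dvd_right _ _) (Nat.gcd_dvd_right _ _))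
      (c₁₃.of_dvd (Nat.gcd_dvd_right _ _) (Nat.gcd_dvd_right _ _))
      (c₂₃.of_dvd (Nat.gcd_dvd_right _ _) (Nat.gcd_dvd_right _ _)) hM hw hwb (Real.sqrt_nonneg _)
      hX1 (le_trans (by gcongr) hX)
    rw [hff, Real.sq_sqrt (by positivity)] at h
    rw [← mul_sub, abs_mul]
    calc _ ≤ 1 * _ := mul_le_mul (abs_moebius_le_one _) h (abs_nonneg _) zero_le_one
      _ ≤ E := by
        rw [one_mul, hE]
        have := Real.log_nonneg hX1
        gcongr
  calc _ ≤ ∑ f ∈ n.divisors, E * n.divisors.card := by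
        refine (Finset.abs_sum_le_sum_abs _ _).trans (Finset.sum_le_sum fun f hf => ?_)
        rw [← Finset.sum_sub_distrib]
        refine (Finset.abs_sum_le_sum_abs _ _).trans ?_
        refine (Finset.sum_le_sum (hterm f hf)).trans ?_
        rw [Finset.sum_const, nsmul_eq_mul, mul_comm]
        gcongr
        exact Nat.dvd_of_mem_divisors hf
    _ = (n.divisors.card : ℝ) ^ 2 * E := by rw [Finset.sum_const, nsmul_eq_mul]; ring
    _ ≤ 4 * n * E := by gcongr; exact card_divisors_sq_le n

/-! ### From the zoom and the height to a sector -/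

/-- The equation says that the distance equals `κ` at slope `x = s + w`, that is `x² + κ x = s² (1 +
κ)`; the witness is the positive root of this quadratic. -/
theorem exists_slope_width {s κ : ℝ} (hs : 1 < s) (hκ : 0 < κ) :
    ∃ w : ℝ, 0 < w ∧ w * (2 * s + w) = κ * (s ^ 2 - s - w) := by
  set R := √(κ ^ 2 + 4 * s ^ 2 * (1 + κ)) with hR
  have hR2 : R ^ 2 = κ ^ 2 + 4 * s ^ 2 * (1 + κ) := Real.sq_sqrt (by positivity)
  refine ⟨(-κ + R) / 2 - s, ?_, by linear_combination hR2 / 4⟩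
  have : κ + 2 * s < R := by
    rw [hR]
    refine Real.lt_sqrt_of_sq_lt ?_
    nlinarith [mul_pos hκ (show 0 < s * (s - 1) by nlinarith)]
  linarith

theorem slope_width_bounds {s κ w : ℝ} (hs : 1 < s) (hκ : 0 < κ) (hw : 0 < w)
    (hroot : w * (2 * s + w) = κ * (s ^ 2 - s - w)) : s + w < s ^ 2 ∧ w ≤ κ * (s - 1) / 2 := by
  have h1 : 0 < κ * (s ^ 2 - s - w) := by rw [← hroot]; positivity
  have h2 := pos_of_mul_pos_right h1 hκ.le
  refine ⟨by linarith, ?_⟩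
  have h3 : s * (2 * w) ≤ s * (κ * (s - 1)) := by nlinarith [mul_pos hκ hw]
  have := le_of_mul_le_mul_left h3 (by linarith)
  linarith

theorem nodalDist_le_iff {a b u v : ℕ} {s κ w D : ℝ} (hs : 1 < s) (hκ : 0 < κ) (hw : 0 < w)
    (hD : 0 < D) (hs2 : s ^ 2 = (b : ℝ) / a)
    (hroot : w * (2 * s + w) = κ * (s ^ 2 - s - w)) (hsx : s < (u : ℝ) / v) :
    ((u : ℝ) / v < (b : ℝ) / a ∧ D * nodalDist a b u v ≤ D * κ) ↔ (u : ℝ) / v ≤ s + w := by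
  obtain ⟨hws, -⟩ := slope_width_bounds hs hκ hw hroot
  rw [nodalDist, ← hs2]
  set x : ℝ := (u : ℝ) / v
  have key : x < s ^ 2 → ((x ^ 2 - s ^ 2) / (s ^ 2 - x) ≤ κ ↔ x ≤ s + w) := by
    intro hx
    rw [div_le_iff₀ (by linarith)]
    -- `s + w` is one root of the quadratic in `x`, and the other factor is positive. The bound `x <
    -- s² = b/a` then follows from `x ≤ s + w < s²`.
    have e : κ * (s ^ 2 - x) - (x ^ 2 - s ^ 2) = (s + w - x) * (x + (s + w) + κ) := by
      linear_combination -hroot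
    rw [← sub_nonneg, e, mul_nonneg_iff_of_pos_right (by linarith), sub_nonneg]
  rw [mul_le_mul_iff_right₀ hD]
  constructor
  · rintro ⟨h1, h2⟩
    exact (key h1).1 h2
  · intro h
    have h1 : x < s ^ 2 := by linarith
    exact ⟨h1, (key h1).2 h⟩

theorem nodalHeight_le_iff {a b u v : ℕ} {B : ℝ} (ha : 0 < a) (hab : a < b) (hB : 0 ≤ B)
    (huv : v ≤ u) : nodalHeight a b u v ≤ B ↔
      (u : ℝ) * ((u : ℝ) - v) ≤ √B / (a * √b) * gcdProd a b ((v : ℤ), (u : ℤ)) := by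
  have har : (0 : ℝ) < a := by exact_mod_cast ha
  have hbr : (0 : ℝ) < b := by exact_mod_cast (ha.trans hab)
  have hg : (Nat.gcd v a : ℝ) * (Nat.gcd u b : ℝ) *
      (Int.gcd ((u : ℤ) - (v : ℤ)) ((b : ℤ) - (a : ℤ)) : ℝ) =
      gcdProd a b ((v : ℤ), (u : ℤ)) := by
    rw [gcdProd, Nat.cast_sub hab.le]
    push_cast
    rfl
  have hg0 : (0 : ℝ) < gcdProd a b ((v : ℤ), (u : ℤ)) := by
    have : 0 < gcdProd a b ((v : ℤ), (u : ℤ)) := by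
      refine Nat.pos_of_dvd_of_pos (gcdProd_dvd a b _) ?_
      have : 0 < b := by omega
      have : 0 < b - a := by omega
      positivity
    exact_mod_cast this
  have huv' : (0 : ℝ) ≤ u - v := sub_nonneg.2 (by exact_mod_cast huv)
  have hb2 : √(b : ℝ) ^ 2 = b := Real.sq_sqrt hbr.le
  have hB2 : √B ^ 2 = B := Real.sq_sqrt hB
  have hsb : 0 < √(b : ℝ) := Real.sqrt_pos.2 hbr
  rw [nodalHeight, hg, div_le_iff₀ (by positivity), div_mul_eq_mul_div, le_div_iff₀ (by positivity)]
  have e1 : (b : ℝ) * ((u : ℝ) * a * ((u : ℝ) - v)) ^ 2 = (u * (u - v) * (a * √b)) ^ 2 := by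
    nth_rewrite 1 [← hb2]; ring
  have e2 : B * (gcdProd a b ((v : ℤ), (u : ℤ)) : ℝ) ^ 2 =
      (√B * gcdProd a b ((v : ℤ), (u : ℤ))) ^ 2 := by
    nth_rewrite 1 [← hB2]; ring
  rw [e1, e2, sq_le_sq₀ (by positivity) (by positivity)]

theorem mem_zoomSet_iff {a b : ℕ} {s κ w ε B r : ℝ} (ha : 0 < a) (hab : a < b) (hs : 1 < s)
    (hs2 : s ^ 2 = (b : ℝ) / a) (hκ : 0 < κ) (hB : 0 < B) (hκε : B ^ (1 / r) * κ = ε) (hw : 0 < w)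
    (hroot : w * (2 * s + w) = κ * (s ^ 2 - s - w)) {p : ℕ × ℕ} :
    p ∈ zoomSet a b ε B r ↔ 0 < p.2 ∧ Nat.Coprime p.1 p.2 ∧ s * p.2 < p.1 ∧
      (p.1 : ℝ) ≤ (s + w) * p.2 ∧ (p.1 : ℝ) * ((p.1 : ℝ) - p.2) ≤
        √B / (a * √b) * gcdProd a b ((p.2 : ℤ), (p.1 : ℤ)) := by
  obtain ⟨u, v⟩ := p
  have hsq : √((b : ℝ) / a) = s := by rw [← hs2, Real.sqrt_sq (by linarith)]
  have hD : 0 < B ^ (1 / r) := Real.rpow_pos_of_pos hB _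
  have huv : 0 < v → s < (u : ℝ) / v → v ≤ u := by
    intro hv h
    have hvr : (0 : ℝ) < v := by exact_mod_cast hv
    rw [lt_div_iff₀ hvr] at h
    have : (v : ℝ) ≤ u := by nlinarith
    exact_mod_cast this
  simp only [zoomSet, Set.mem_ofPred_eq, hsq]
  constructor
  · rintro ⟨-, hv, hc, h1, h2, h3, h4⟩
    have hvr : (0 : ℝ) < v := by exact_mod_cast hv
    have h5 := (nodalDist_le_iff hs hκ hw hD hs2 hroot h1).1 ⟨h2, by rwa [hκε]⟩
    exact ⟨hv, hc, (lt_div_iff₀ hvr).1 h1, (div_le_iff₀ hvr).1 h5,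
      (nodalHeight_le_iff ha hab hB.le (huv hv h1)).1 h4⟩
  · rintro ⟨hv, hc, h1, h5, h4⟩
    have hvr : (0 : ℝ) < v := by exact_mod_cast hv
    have h1' := (lt_div_iff₀ hvr).2 h1
    obtain ⟨h2, h3⟩ := (nodalDist_le_iff hs hκ hw hD hs2 hroot h1').2 ((div_le_iff₀ hvr).2 h5)
    rw [hκε] at h3
    exact ⟨hv.trans_le (huv hv h1'), hv, hc, h1', h2, h3,
      (nodalHeight_le_iff ha hab hB.le (huv hv h1')).2 h4⟩

/-- The zoomed set is squeezed between two sets cut out by bounds on the denominator. -/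
theorem zoomSet_squeeze {a b : ℕ} {s κ w ε B r : ℝ} (ha : 0 < a) (hab : a < b) (hs : 1 < s)
    (hs2 : s ^ 2 = (b : ℝ) / a) (hκ : 0 < κ) (hB : 0 < B) (hκε : B ^ (1 / r) * κ = ε) (hw : 0 < w)
    (hroot : w * (2 * s + w) = κ * (s ^ 2 - s - w)) :
    (zoomSet a b ε B r).Finite ∧
    (heightSector a b s w (√B / (a * √b) / ((s + w) * (s + w - 1)))).card ≤
      (zoomSet a b ε B r).ncard ∧
    (zoomSet a b ε B r).ncard ≤
      (heightSector a b s w (√B / (a * √b) / (s * (s - 1)))).card := by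
  set T := √B / (a * √b) with hT
  have hT0 : 0 ≤ T := by positivity
  set φ : ℕ × ℕ → ℤ × ℤ := fun p => ((p.2 : ℤ), (p.1 : ℤ)) with hφ
  have hinj : Function.Injective φ := by
    rintro ⟨x, y⟩ ⟨x', y'⟩ h
    simp only [hφ, Prod.mk.injEq, Nat.cast_inj] at h
    rw [h.1, h.2]
  have hs0 : 0 < s * (s - 1) := mul_pos (by linarith) (by linarith)
  have hs1 : 0 < (s + w) * (s + w - 1) := mul_pos (by linarith) (by linarith)
  have hup : φ '' zoomSet a b ε B r ⊆ (heightSector a b s w (T / (s * (s - 1))) : Set (ℤ × ℤ)) := by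
    rintro _ ⟨⟨u, v⟩, h, rfl⟩
    obtain ⟨hv, hc, h1, h2, h3⟩ :=
      (mem_zoomSet_iff ha hab hs hs2 hκ hB hκε hw hroot).1 h
    simp only at hv hc h1 h2 h3
    have hvr : (0 : ℝ) < v := by exact_mod_cast hv
    rw [Finset.mem_coe, mem_heightSector ha hab (by positivity)]
    refine ⟨Int.natCast_pos.2 hv, ?_, by simpa [hφ] using h1, by simpa [hφ] using h2, ?_⟩
    · simpa [hφ, Int.gcd_natCast_natCast] using hc.symm
    · rw [div_mul_eq_mul_div, le_div_iff₀ hs0]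
      refine le_trans ?_ h3
      -- In the sector `u ≥ s v` and `u - v ≥ (s - 1) v`; the upper edge gives the reverse bounds
      -- for the other inclusion.
      have : (s * v) * ((s - 1) * v) ≤ (u : ℝ) * (u - v) := by
        apply mul_le_mul <;> nlinarith
      simp only [hφ, Int.cast_natCast]
      linarith
  have hlow : (heightSector a b s w (T / ((s + w) * (s + w - 1))) : Set (ℤ × ℤ)) ⊆
      φ '' zoomSet a b ε B r := by
    rintro ⟨v, u⟩ h
    rw [Finset.mem_coe, mem_heightSector ha hab (by positivity)] at h
    obtain ⟨hv, hc, h1, h2, h3⟩ := h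
    simp only at hv hc h1 h2 h3
    have hvr : (0 : ℝ) < v := by exact_mod_cast hv
    have hur : (0 : ℝ) < u := lt_trans (by positivity) h1
    have hu : 0 < u := by exact_mod_cast hur
    lift v to ℕ using hv.le
    lift u to ℕ using hu.le
    simp only [Int.cast_natCast] at h1 h2 h3 hvr hur
    refine ⟨(u, v), (mem_zoomSet_iff ha hab hs hs2 hκ hB hκε hw hroot).2
      ⟨by exact_mod_cast hv, ?_, h1, h2, ?_⟩, rfl⟩
    · rw [Int.gcd_natCast_natCast] at hc
      exact Nat.Coprime.symm hc
    · rw [div_mul_eq_mul_div, le_div_iff₀ hs1] at h3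
      refine le_trans ?_ h3
      have : (u : ℝ) * (u - v) ≤ ((s + w) * v) * ((s + w - 1) * v) := by
        apply mul_le_mul <;> nlinarith
      simp only
      linarith
  have hfin : (zoomSet a b ε B r).Finite :=
    Set.Finite.of_finite_image ((Finset.finite_toSet _).subset hup) hinj.injOn
  refine ⟨hfin, ?_, ?_⟩
  · rw [← Set.ncard_image_of_injective _ hinj, ← Set.ncard_coe_finset]
    exact Set.ncard_le_ncard hlow (hfin.image φ)
  · rw [← Set.ncard_image_of_injective _ hinj, ← Set.ncard_coe_finset]
    exact Set.ncard_le_ncard hup (Finset.finite_toSet _)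

/-- The area `w Y` is close to `κ T / (2 s)` for both bounds of the squeeze. -/
theorem slope_width_mul_bounds {s κ w T : ℝ} (hs : 1 < s) (hκ : 0 < κ) (hw : 0 < w) (hT : 0 ≤ T)
    (hroot : w * (2 * s + w) = κ * (s ^ 2 - s - w)) :
    w * (T / (s * (s - 1))) ≤ κ * T / (2 * s) ∧
    T / ((s + w) * (s + w - 1)) ≤ T / (s * (s - 1)) ∧
    κ * T / (2 * s) - T * κ ^ 2 ≤ w * (T / ((s + w) * (s + w - 1))) := by
  obtain ⟨-, hwκ⟩ := slope_width_bounds hs hκ hw hroot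
  have hs1 : 0 < s - 1 := by linarith
  have hs0 : 0 < s * (s - 1) := by positivity
  have hsw : 0 < (s + w) * (s + w - 1) := mul_pos (by linarith) (by linarith)
  -- `hroot` cancels the first-order terms. Since `w ≤ κ(s - 1)/2`, each of the two gaps is at most
  -- `T κ²/2`.
  have e1 : κ * T / (2 * s) - w * (T / (s * (s - 1))) =
      T * (w * (κ + w) / (2 * s ^ 2 * (s - 1))) := by
    field_simp
    linear_combination -T * hroot
  have e2 : w * (T / (s * (s - 1))) - w * (T / ((s + w) * (s + w - 1))) =
      T * (w ^ 2 * (2 * s + w - 1) / (s * (s - 1) * ((s + w) * (s + w - 1)))) := by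
    have : s + w - 1 ≠ 0 := by linarith
    field_simp
    ring
  have b1 : w * (κ + w) / (2 * s ^ 2 * (s - 1)) ≤ κ ^ 2 / 2 := by
    rw [div_le_iff₀ (by positivity)]
    have h1 : w * (κ + w) ≤ κ * (s - 1) / 2 * (κ + κ * (s - 1) / 2) := by gcongr
    have h2 : κ * (s - 1) / 2 * (κ + κ * (s - 1) / 2) = κ ^ 2 / 2 * (s - 1) * ((s + 1) / 2) := by
      ring
    have h3 : κ ^ 2 / 2 * (s - 1) * ((s + 1) / 2) ≤ κ ^ 2 / 2 * (s - 1) * (2 * s ^ 2) := by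
      gcongr
      nlinarith
    linarith
  have b2 : w ^ 2 * (2 * s + w - 1) / (s * (s - 1) * ((s + w) * (s + w - 1))) ≤ κ ^ 2 / 2 := by
    rw [div_le_iff₀ (by positivity)]
    have h1 : w ^ 2 * (2 * s + w - 1) ≤ (κ * (s - 1) / 2) ^ 2 * (2 * (s + w)) := by
      gcongr <;> linarith
    have h2 : (κ * (s - 1) / 2) ^ 2 * (2 * (s + w)) =
        κ ^ 2 / 2 * (1 * (s - 1) * ((s + w) * (s - 1))) := by ring
    have h3 : κ ^ 2 / 2 * (1 * (s - 1) * ((s + w) * (s - 1))) ≤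
        κ ^ 2 / 2 * (s * (s - 1) * ((s + w) * (s + w - 1))) := by
      gcongr
      linarith
    linarith
  have p1 : 0 ≤ T * (w * (κ + w) / (2 * s ^ 2 * (s - 1))) := by positivity
  refine ⟨by linarith, ?_, ?_⟩
  · gcongr
    · linarith
    · linarith
  · have t1 := mul_le_mul_of_nonneg_left b1 hT
    have t2 := mul_le_mul_of_nonneg_left b2 hT
    linarith

/-! ### Uniform error terms and conclusion -/

/-- If `a u² = b v²` with `v ≠ 0` then `ab` is a square, and coprimality makes both factors squares.
This is the irrationality of `√(b/a)`. -/
theorem mul_sq_sub_mul_sq_ne_zero {a b : ℕ} (hcop : a.Coprime b)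
    (hsq : ¬ (IsSquare a ∧ IsSquare b)) (u v : ℤ) (hv : v ≠ 0) :
    (a : ℤ) * u ^ 2 - b * v ^ 2 ≠ 0 := by
  intro h
  have h1 : (a * u : ℤ) ^ 2 = a * b * v ^ 2 := by linear_combination (a : ℤ) * h
  obtain ⟨t, ht⟩ : v ∣ a * u := (Int.pow_dvd_pow_iff two_ne_zero).1 ⟨a * b, by rw [h1]; ring⟩
  have h2 : (a * b : ℤ) = t ^ 2 := by
    have : v ^ 2 * (a * b : ℤ) = v ^ 2 * t ^ 2 := by rw [← mul_pow, ← ht, h1]; ring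
    exact mul_left_cancel₀ (pow_ne_zero 2 hv) this
  have h3 : a * b = t.natAbs ^ 2 := by
    have := congrArg Int.natAbs h2
    rwa [Int.natAbs_mul, Int.natAbs_pow, Int.natAbs_natCast, Int.natAbs_natCast] at this
  have key : ∀ x y c : ℕ, x.Coprime y → x * y = c ^ 2 → IsSquare x := fun x y c hxy hc => by
    obtain ⟨d, hd⟩ := exists_eq_pow_of_mul_eq_pow (Nat.isUnit_iff.2 hxy) hc
    exact ⟨d, by rw [hd, sq]⟩
  exact hsq ⟨key a b _ hcop h3, key b a _ hcop.symm (by rw [mul_comm, h3])⟩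

theorem abs_Psi_le {n : ℕ} (hn : n ≠ 0) : |Psi n| ≤ 4 * n := by
  refine le_trans ?_ (card_divisors_sq_le n)
  rw [Psi, sq]
  refine (Finset.abs_sum_le_sum_abs _ _).trans ?_
  rw [← nsmul_eq_mul]
  refine Finset.sum_le_card_nsmul _ _ _ fun d hd => ?_
  rw [abs_mul, abs_of_nonneg (Psi₁_nonneg d)]
  have h1 : |∑ e ∈ d.divisors, (ArithmeticFunction.moebius e : ℝ) / (e : ℝ)| ≤ d.divisors.card := by
    refine (Finset.abs_sum_le_sum_abs _ _).trans ?_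
    rw [← nsmul_one]
    refine Finset.sum_le_card_nsmul _ _ _ fun e he => ?_
    have : (1 : ℝ) ≤ e := by exact_mod_cast Nat.pos_of_mem_divisors he
    rw [abs_div, Nat.abs_cast]
    exact div_le_one_of_le₀ ((abs_moebius_le_one e).trans this) (by linarith)
  have h2 : (d.divisors.card : ℝ) ≤ n.divisors.card := by
    exact_mod_cast Finset.card_le_card (Nat.divisors_subset_of_dvd hn (Nat.dvd_of_mem_divisors hd))
  calc _ ≤ 1 * (n.divisors.card : ℝ) := by
        gcongr
        · exact Psi₁_le_one d
        · exact h1.trans h2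
    _ = _ := one_mul _

/-- Needed so that `log B ≥ log 2` can absorb constants. As `b - a ≥ 1` and `b/a < τ₁²`, one has `b
(τ₁² - 1) > 1`: when `τ₁` is close to 1, `b` is large enough for `b^8` to beat `32 τ₁/(τ₁ - 1)`. -/
theorem two_le_of_rpow_le {τ₁ τ₂ B η : ℝ} {a b : ℕ} (hτ₂ : 1 < τ₂) (hτ : τ₂ < τ₁)
    (hab : a < b) (ha : 0 < a) (hba : (b : ℝ) / a < τ₁ ^ 2) (hB : 0 < B) (hη : 0 < η) (hη1 : η ≤ 1)
    (h : (b : ℝ) ^ (17 / 2 : ℝ) ≤ 16 * τ₂ / (τ₁ - 1) * B ^ η) : 2 ≤ B := by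
  have har : (1 : ℝ) ≤ a := by exact_mod_cast ha
  have hab1 : (a : ℝ) + 1 ≤ b := by exact_mod_cast hab
  have ht : 0 < τ₁ - 1 := by linarith
  set t := τ₁ - 1 with htdef
  have hb8 : (b : ℝ) ^ 8 ≤ (b : ℝ) ^ (17 / 2 : ℝ) := by
    rw [← Real.rpow_natCast]
    exact Real.rpow_le_rpow_of_exponent_le (by linarith) (by norm_num)
  have hbt : 1 < b * (t * (t + 2)) := by
    rw [div_lt_iff₀ (by linarith)] at hba
    have e : τ₁ ^ 2 = 1 + t * (t + 2) := by rw [htdef]; ring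
    rw [e] at hba
    nlinarith [mul_pos ht (show 0 < t + 2 by linarith)]
  have key : 32 * (1 + t) ≤ t * (b : ℝ) ^ 8 := by
    rcases le_or_gt (1 / 7) t with h7 | h7
    -- For `t ≥ 1/7` the value `b = 2` already suffices, `256 t ≥ 32 (1 + t)` being exactly this
    -- threshold; below it `t + 2 < 15/7`, so `b t > 7/15` and `b > 3`.
    · have : (2 : ℝ) ^ 8 ≤ (b : ℝ) ^ 8 := by gcongr; linarith
      nlinarith
    · have h1 : 7 / 15 < b * t := by nlinarith [mul_pos (show (0 : ℝ) < b by linarith) ht]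
      have h2 : (3 : ℝ) ≤ b := by nlinarith
      have h3 : (3 : ℝ) ^ 7 ≤ (b : ℝ) ^ 7 := by gcongr
      have h4 : 7 / 15 * (3 : ℝ) ^ 7 ≤ (b * t) * (b : ℝ) ^ 7 := by gcongr
      calc 32 * (1 + t) ≤ 7 / 15 * (3 : ℝ) ^ 7 := by norm_num; linarith
        _ ≤ _ := h4
        _ = _ := by ring
  have h2 : 2 ≤ B ^ η := by
    by_contra! hlt
    have h3 : 16 * τ₂ / t * B ^ η ≤ 16 * (1 + t) / t * B ^ η := by
      gcongr
      linarith
    have h4 : 16 * (1 + t) / t * B ^ η < 16 * (1 + t) / t * 2 := by gcongr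
    have h5 : 16 * (1 + t) / t * 2 ≤ (b : ℝ) ^ 8 := by
      rw [div_mul_eq_mul_div, div_le_iff₀ ht]
      linarith
    linarith
  rcases le_or_gt B 1 with h1 | h1
  · have := Real.rpow_le_one hB.le h1 hη.le
    linarith
  · have := Real.rpow_le_rpow_of_exponent_le h1.le hη1
    rw [Real.rpow_one] at this
    linarith

/-- The fourth root of the hypothesis bounds `b^(17/8)`, hence `b^(15/8)`, by `B^(η/4)` up to a
constant, and `19/4 = 23/8 + 15/8`. -/
theorem rpow_mul_rpow_le {b B η K : ℝ} (hb : 1 ≤ b) (hB : 0 < B) (hK : 0 ≤ K)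
    (h : b ^ (17 / 2 : ℝ) ≤ K * B ^ η) :
    b ^ (19 / 4 : ℝ) * B ^ (η / 2) ≤
      K ^ (1 / 4 : ℝ) * (b ^ (23 / 8 : ℝ) * B ^ (3 / 4 * η)) := by
  have hb0 : 0 < b := by linarith
  have h1 : b ^ (15 / 8 : ℝ) ≤ K ^ (1 / 4 : ℝ) * B ^ (η / 4) := by
    calc b ^ (15 / 8 : ℝ) ≤ b ^ (17 / 2 * (1 / 4) : ℝ) :=
          Real.rpow_le_rpow_of_exponent_le hb (by norm_num)
      _ = (b ^ (17 / 2 : ℝ)) ^ (1 / 4 : ℝ) := Real.rpow_mul hb0.le _ _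
      _ ≤ (K * B ^ η) ^ (1 / 4 : ℝ) := Real.rpow_le_rpow (by positivity) h (by norm_num)
      _ = K ^ (1 / 4 : ℝ) * B ^ (η / 4) := by
        rw [Real.mul_rpow hK (by positivity), ← Real.rpow_mul hB.le]
        ring_nf
  calc b ^ (19 / 4 : ℝ) * B ^ (η / 2) = b ^ (23 / 8 : ℝ) * b ^ (15 / 8 : ℝ) * B ^ (η / 2) := by
        rw [← Real.rpow_add hb0]; norm_num
    _ ≤ b ^ (23 / 8 : ℝ) * (K ^ (1 / 4 : ℝ) * B ^ (η / 4)) * B ^ (η / 2) := by gcongr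
    _ = K ^ (1 / 4 : ℝ) * (b ^ (23 / 8 : ℝ) * (B ^ (η / 4) * B ^ (η / 2))) := by ring
    _ = _ := by rw [← Real.rpow_add hB]; ring_nf

/-- The count of `heightSector`, with an error term uniform in all parameters. -/
theorem abs_card_heightSector_sub_le_rpow {a b : ℕ} {s w Y M M' X A G ε₀ Z : ℝ} (ha : 0 < a)
    (hab : a < b) (hcop : a.Coprime b) (hs : 0 < s) (hs2 : a * s ^ 2 = b)
    (hirr : ∀ u v : ℤ, v ≠ 0 → (a : ℤ) * u ^ 2 - b * v ^ 2 ≠ 0)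
    (hM : 1 ≤ M) (hsM : 2 * s + M ≤ M') (hw : 0 < w) (hwb : w * b ^ 2 ≤ M) (hY : 0 ≤ Y)
    (hX1 : 1 ≤ X) (hG : 0 ≤ G) (hYG : w * Y * (a * b * (b - a) : ℕ) ≤ G ^ 2 * b ^ (3 / 2 : ℝ))
    (hX : G * b ^ (3 / 4 : ℝ) * √(b * M') ≤ X) (hA1 : A - ε₀ ≤ w * Y) (hA2 : w * Y ≤ A)
    (hZ : 2 + Real.log X ≤ Z) :
    |((heightSector a b s w Y).card : ℝ) -
        3 / Real.pi ^ 2 * A * (Psi b * Psi a * Psi (b - a))| ≤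
      60 * M ^ 2 * M' * (b ^ (19 / 4 : ℝ) * G) * Z + 4 * ε₀ * b ^ 3 := by
  have har : (1 : ℝ) ≤ a := by exact_mod_cast ha
  have hab' : (a : ℝ) ≤ b := by exact_mod_cast hab.le
  have hb0 : (0 : ℝ) < b := by linarith
  have c₁₃ : a.Coprime (b - a) := (Nat.coprime_sub_self_right hab.le).2 hcop
  have c₂₃ : b.Coprime (b - a) := by
    rw [Nat.coprime_comm]
    exact (Nat.coprime_self_sub_left hab.le).2 hcop
  set n := a * b * (b - a) with hn
  have hn0 : n ≠ 0 := by
    have : 0 < b := by omega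
    have : 0 < b - a := by omega
    positivity
  have hnb : (n : ℝ) ≤ (b : ℝ) ^ 3 := by
    have : n ≤ b * b * b := by
      rw [hn]; gcongr; exact Nat.sub_le _ _
    calc (n : ℝ) ≤ ((b * b * b : ℕ) : ℝ) := by exact_mod_cast this
      _ = _ := by push_cast; ring
  have hPsi : Psi b * Psi a * Psi (b - a) = Psi n := by
    rw [hn, Psi_mul (c₁₃.mul_left c₂₃), Psi_mul hcop, mul_comm (Psi b)]
  have hsq : √(Y * n) * √w ≤ G * b ^ (3 / 4 : ℝ) := by
    rw [← Real.sqrt_mul (by positivity), Real.sqrt_le_left (by positivity), mul_pow,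
      ← Real.rpow_natCast (_ ^ _), ← Real.rpow_mul hb0.le]
    norm_num
    linarith
  have hD : (a : ℝ) * (2 * s + M) ≤ b * M' := by gcongr
  have hX' : √(Y * n) * √(w * (a * (2 * s + M))) ≤ X := by
    rw [Real.sqrt_mul hw.le, ← mul_assoc]
    exact le_trans (by gcongr) hX
  have hmain := abs_card_heightSector_sub_le ha hab hcop hs hs2 hirr hM hw hwb hY hX1 hX'
  rw [hPsi] at hmain ⊢
  have hlog := Real.log_nonneg hX1
  have hM' : 0 ≤ M' := by linarith
  have herr : 4 * (n : ℝ) * (15 * M ^ 2 * (a * (2 * s + M)) * (√(Y * n) * √w) * (2 + Real.log X))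
      ≤ 60 * M ^ 2 * M' * (b ^ (19 / 4 : ℝ) * G) * Z := by
    -- `19/4 = 3 + 1 + 3/4`: the pairs of divisors give `b³`, the approximation constant `b`, and
    -- the size of the sector `b^(3/4)`.
    calc _ ≤ 4 * (b : ℝ) ^ 3 * (15 * M ^ 2 * (b * M') * (G * b ^ (3 / 4 : ℝ)) * Z) := by gcongr
      _ = 60 * M ^ 2 * M' * ((b : ℝ) ^ 4 * b ^ (3 / 4 : ℝ) * G) * Z := by ring
      _ = _ := by
        rw [← Real.rpow_natCast (b : ℝ) 4, ← Real.rpow_add hb0]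
        norm_num
  have hdiff : |3 / Real.pi ^ 2 * (w * Y) * Psi n - 3 / Real.pi ^ 2 * A * Psi n| ≤
      4 * ε₀ * b ^ 3 := by
    rw [← sub_mul, ← mul_sub, abs_mul, abs_mul]
    have h1 : |3 / Real.pi ^ 2| ≤ 1 := by
      rw [abs_of_nonneg (by positivity), div_le_one (by positivity)]
      nlinarith [Real.pi_gt_three]
    have h2 : |w * Y - A| ≤ ε₀ := by rw [abs_le]; constructor <;> linarith
    have h3 : 0 ≤ ε₀ := (abs_nonneg _).trans h2
    calc _ ≤ 1 * ε₀ * (4 * n) := by gcongr; exact abs_Psi_le hn0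
      _ ≤ 1 * ε₀ * (4 * b ^ 3) := by gcongr
      _ = _ := by ring
  calc _ ≤ _ := abs_sub_le _ (3 / Real.pi ^ 2 * (w * Y) * Psi n) _
    _ ≤ _ := add_le_add (hmain.trans herr) hdiff

set_option maxHeartbeats 1000000 in
theorem exists_abs_ncard_zoomSet_sub_le {τ₁ τ₂ ε : ℝ} (hτ₂ : 1 < τ₂) (hτ : τ₂ < τ₁) (hε : 0 < ε) :
    ∃ C : ℝ, 0 ≤ C ∧ ∀ (r : ℝ) (a b : ℕ) (B : ℝ), 2 < r → r < 144 / 55 →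
      0 < a → a < b → Nat.Coprime a b → ¬ (IsSquare a ∧ IsSquare b) →
      τ₂ ^ 2 < (b : ℝ) / a → (b : ℝ) / a < τ₁ ^ 2 → 0 < B →
      (b : ℝ) ^ (17 / 2 : ℝ) ≤ 16 * τ₂ / (τ₁ - 1) * B ^ (1 / 2 - 1 / r) →
      0 < Real.log B ∧ (zoomSet a b ε B r).Finite ∧
      |((zoomSet a b ε B r).ncard : ℝ) -
          3 / (2 * Real.pi ^ 2) * (Psi b * Psi a * Psi (b - a) / ((b : ℝ) * (a : ℝ) ^ (1 / 2 : ℝ))) *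
            ε * B ^ (1 / 2 - 1 / r)| ≤
        C * ((b : ℝ) ^ (23 / 8 : ℝ) * B ^ (3 / 4 * (1 / 2 - 1 / r)) * Real.log B) := by
  set K := 16 * τ₂ / (τ₁ - 1) with hK
  have hK0 : 0 < K := div_pos (by linarith) (by linarith)
  -- Chosen so that `w b² ≤ M`: indeed `w ≤ κ τ₁`, `b² ≤ K B^η ≤ K B^(1/r)` and `κ B^(1/r) = ε`.
  set M := max 1 (K * ε * τ₁) with hMdef
  have hM : 1 ≤ M := le_max_left _ _
  set M' := 2 * τ₁ + M with hM'
  have hM'0 : 0 < M' := by linarith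
  set c := √(ε * M' * K) with hc
  have hc0 : 0 ≤ c := Real.sqrt_nonneg _
  have hlogc : 0 ≤ Real.log (1 + c) := Real.log_nonneg (by linarith)
  set C₂ := (2 + Real.log (1 + c)) / Real.log 2 + 1 with hC₂
  have hlog2 : 0 < Real.log 2 := Real.log_pos one_lt_two
  have hC₂0 : 0 ≤ C₂ := by positivity
  set C₁ := 60 * M ^ 2 * M' * √ε * C₂ + 4 * ε ^ 2 / Real.log 2 with hC₁
  have hC₁0 : 0 ≤ C₁ := by positivity
  refine ⟨C₁ * K ^ (1 / 4 : ℝ), by positivity, ?_⟩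
  intro r a b B hr2 hr ha hab hcop hsq hba2 hba1 hB hbig
  have hr0 : 0 < r := by linarith
  have hrinv1 : 1 / r < 1 / 2 := one_div_lt_one_div_of_lt (by norm_num) hr2
  -- Hence `η < 17/144 < 1/r` and `B^η ≤ B^(1/r)`, which bounds both `w b²` and the squeeze loss `T
  -- κ²`.
  have hrinv2 : 55 / 144 < 1 / r := by
    rw [lt_div_iff₀ hr0]; linarith
  set η := 1 / 2 - 1 / r with hη
  have hη0 : 0 < η := by linarith
  have hB2 : 2 ≤ B := two_le_of_rpow_le hτ₂ hτ hab ha hba1 hB hη0 (by linarith) hbig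
  have hB1 : 1 ≤ B := by linarith
  have hL : Real.log 2 ≤ Real.log B := Real.log_le_log two_pos hB2
  have har : (1 : ℝ) ≤ a := by exact_mod_cast ha
  have hab' : (a : ℝ) ≤ b := by exact_mod_cast hab.le
  have hb1 : (1 : ℝ) ≤ b := by linarith
  have hb0 : (0 : ℝ) < b := by linarith
  set s := √((b : ℝ) / a) with hs
  have hs2 : s ^ 2 = (b : ℝ) / a := Real.sq_sqrt (by positivity)
  have has : a * s ^ 2 = b := by rw [hs2]; field_simp
  have hsτ₂ : τ₂ < s := Real.lt_sqrt_of_sq_lt hba2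
  have hsτ₁ : s < τ₁ := by
    rw [hs, Real.sqrt_lt' (by linarith)]; exact hba1
  have hs1 : 1 < s := by linarith
  have hBr : 0 < B ^ (1 / r) := Real.rpow_pos_of_pos hB _
  have hBη : 0 < B ^ η := Real.rpow_pos_of_pos hB _
  set κ := ε / B ^ (1 / r) with hκdef
  have hκ : 0 < κ := by positivity
  have hκε : B ^ (1 / r) * κ = ε := by rw [hκdef]; field_simp
  obtain ⟨w, hw, hroot⟩ := exists_slope_width hs1 hκ
  obtain ⟨-, hwκ⟩ := slope_width_bounds hs1 hκ hw hroot
  obtain ⟨hfin, hlow, hup⟩ := zoomSet_squeeze ha hab hs1 hs2 hκ hB hκε hw hroot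
  set T := √B / (a * √b) with hT
  have hT0 : 0 ≤ T := by positivity
  obtain ⟨hA2, hYY, hA1⟩ := slope_width_mul_bounds hs1 hκ hw hT0 hroot
  have hBsplit : √B = B ^ η * B ^ (1 / r) := by
    rw [Real.sqrt_eq_rpow, ← Real.rpow_add hB, hη]; ring_nf
  -- The main term: `s = √b/√a` and `√B = B^η B^(1/r)`, the last factor cancelling against `κ`.
  have hA : κ * T / (2 * s) = ε * B ^ η / (2 * (b * √a)) := by
    have hsa : s = √b / √a := Real.sqrt_div hb0.le _
    have h1 : √(a : ℝ) * √a = a := Real.mul_self_sqrt (by linarith)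
    have h2 : √(b : ℝ) * √b = b := Real.mul_self_sqrt hb0.le
    have h3 : 0 < √(a : ℝ) := Real.sqrt_pos.2 (by linarith)
    have h4 : 0 < √(b : ℝ) := Real.sqrt_pos.2 hb0
    rw [hκdef, hT, hsa, hBsplit]
    nth_rewrite 1 [← h1]
    nth_rewrite 3 [← h2]
    field_simp
  have hTκ : T * κ ^ 2 ≤ ε ^ 2 := by
    have h1 : T ≤ √B := by
      refine div_le_self (Real.sqrt_nonneg _) ?_
      exact one_le_mul_of_one_le_of_one_le har (Real.one_le_sqrt.2 hb1)
    have h2 : B ^ η ≤ B ^ (1 / r) := Real.rpow_le_rpow_of_exponent_le hB1 (by linarith)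
    calc T * κ ^ 2 ≤ √B * κ ^ 2 := by gcongr
      _ = B ^ η * (B ^ (1 / r) * κ) * κ := by rw [hBsplit]; ring
      _ ≤ B ^ (1 / r) * (B ^ (1 / r) * κ) * κ := by gcongr
      _ = (B ^ (1 / r) * κ) ^ 2 := by ring
      _ = ε ^ 2 := by rw [hκε]
  have hb2 : (b : ℝ) ^ (2 : ℕ) ≤ K * B ^ η := by
    refine le_trans ?_ hbig
    rw [← Real.rpow_natCast]
    exact Real.rpow_le_rpow_of_exponent_le hb1 (by norm_num)
  have hwb : w * (b : ℝ) ^ 2 ≤ M := by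
    refine le_trans ?_ (le_max_right _ _)
    have h2 : B ^ η ≤ B ^ (1 / r) := Real.rpow_le_rpow_of_exponent_le hB1 (by linarith)
    have h3 : w ≤ κ * τ₁ := by
      have : κ * (s - 1) ≤ κ * τ₁ := by gcongr; linarith
      have : 0 ≤ κ * (s - 1) := mul_nonneg hκ.le (by linarith)
      linarith
    calc w * (b : ℝ) ^ 2 ≤ κ * τ₁ * (K * B ^ (1 / r)) := by
          have h4 : K * B ^ η ≤ K * B ^ (1 / r) := by gcongr
          have h5 : 0 ≤ κ * τ₁ := mul_nonneg hκ.le (by linarith)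
          exact mul_le_mul h3 (hb2.trans h4) (by positivity) h5
      _ = K * (B ^ (1 / r) * κ) * τ₁ := by ring
      _ = K * ε * τ₁ := by rw [hκε]
  set G := √ε * B ^ (η / 2) with hG
  have hG2 : G ^ 2 = ε * B ^ η := by
    rw [hG, mul_pow, Real.sq_sqrt hε.le, ← Real.rpow_natCast (B ^ _), ← Real.rpow_mul hB.le]
    norm_num
  have hAn : κ * T / (2 * s) * (a * b * (b - a) : ℕ) ≤ G ^ 2 * b ^ (3 / 2 : ℝ) := by
    rw [hA, hG2, show (3 / 2 : ℝ) = 1 + 1 / 2 by norm_num, Real.rpow_add hb0, Real.rpow_one,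
      ← Real.sqrt_eq_rpow]
    have h1 : √(a : ℝ) * √a = a := Real.mul_self_sqrt (by linarith)
    have h3 : 0 < √(a : ℝ) := Real.sqrt_pos.2 (by linarith)
    have h5 : √(a : ℝ) ≤ √b := Real.sqrt_le_sqrt hab'
    push_cast [Nat.cast_sub hab.le]
    have e : ε * B ^ η / (2 * (b * √a)) * (a * b * (b - a)) =
        ε * B ^ η * ((b - a) / 2 * √a) := by
      nth_rewrite 2 [← h1]
      field_simp
    rw [e]
    gcongr
    linarith
  have hXbound : G * b ^ (3 / 4 : ℝ) * √(b * M') ≤ (1 + c) * B := by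
    have h1 : (G * b ^ (3 / 4 : ℝ) * √(b * M')) ^ 2 ≤ (c * B ^ η) ^ 2 := by
      rw [mul_pow _ √(b * M'), mul_pow G, mul_pow c, Real.sq_sqrt (by positivity), hG2, hc,
        Real.sq_sqrt (by positivity), ← Real.rpow_natCast (_ ^ (3 / 4 : ℝ)), ← Real.rpow_mul hb0.le]
      have h2 : (b : ℝ) ^ (3 / 4 * (2 : ℕ) : ℝ) * b ≤ K * B ^ η := by
        refine le_trans ?_ hbig
        rw [← Real.rpow_add_one hb0.ne']
        exact Real.rpow_le_rpow_of_exponent_le hb1 (by norm_num)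
      calc _ = ε * B ^ η * M' * ((b : ℝ) ^ (3 / 4 * (2 : ℕ) : ℝ) * b) := by ring
        _ ≤ ε * B ^ η * M' * (K * B ^ η) := by gcongr
        _ = _ := by ring
    have h3 : G * b ^ (3 / 4 : ℝ) * √(b * M') ≤ c * B ^ η :=
      (sq_le_sq₀ (by positivity) (by positivity)).1 h1
    have h4 : B ^ η ≤ B := by
      calc B ^ η ≤ B ^ (1 : ℝ) := Real.rpow_le_rpow_of_exponent_le hB1 (by linarith)
        _ = B := Real.rpow_one B
    have h5 := mul_le_mul_of_nonneg_left h4 hc0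
    linarith
  have hX1 : 1 ≤ (1 + c) * B := one_le_mul_of_one_le_of_one_le (by linarith) hB1
  have hZ : 2 + Real.log ((1 + c) * B) ≤ C₂ * Real.log B := by
    rw [Real.log_mul (by positivity) (by positivity), hC₂, add_mul, one_mul]
    have : 2 + Real.log (1 + c) ≤ (2 + Real.log (1 + c)) / Real.log 2 * Real.log B := by
      rw [div_mul_eq_mul_div, le_div_iff₀ hlog2]
      gcongr
    linarith
  -- Both bounds of the squeeze satisfy these conditions on `Y`, so a single estimate with a single
  -- main term serves for both.
  have est : ∀ Y, 0 ≤ Y → Y ≤ T / (s * (s - 1)) → κ * T / (2 * s) - T * κ ^ 2 ≤ w * Y →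
      |((heightSector a b s w Y).card : ℝ) -
        3 / Real.pi ^ 2 * (κ * T / (2 * s)) * (Psi b * Psi a * Psi (b - a))| ≤
      C₁ * K ^ (1 / 4 : ℝ) * ((b : ℝ) ^ (23 / 8 : ℝ) * B ^ (3 / 4 * η) * Real.log B) := by
    intro Y hY0 hY1 hY2
    have hwY : w * Y ≤ κ * T / (2 * s) := le_trans (by gcongr) hA2
    have h := abs_card_heightSector_sub_le_rpow (M := M) (M' := M') (X := (1 + c) * B) (G := G)
      (ε₀ := ε ^ 2) (A := κ * T / (2 * s)) ha hab hcop (by linarith) has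
      (mul_sq_sub_mul_sq_ne_zero hcop hsq) hM (by linarith) hw hwb hY0 hX1
      (by positivity) (le_trans (by gcongr) hAn) hXbound (by linarith) hwY hZ
    refine h.trans ?_
    have hQ := rpow_mul_rpow_le hb1 hB hK0.le hbig
    have hb3 : (b : ℝ) ^ 3 ≤ b ^ (19 / 4 : ℝ) * B ^ (η / 2) := by
      have h1 : (b : ℝ) ^ 3 ≤ b ^ (19 / 4 : ℝ) := by
        rw [← Real.rpow_natCast]
        exact Real.rpow_le_rpow_of_exponent_le hb1 (by norm_num)
      exact h1.trans (le_mul_of_one_le_right (by positivity)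
        (Real.one_le_rpow hB1 (by linarith)))
    have hlog1 : 1 ≤ Real.log B / Real.log 2 := (one_le_div hlog2).2 hL
    have hL0 : 0 < Real.log B := hlog2.trans_le hL
    set Q := (b : ℝ) ^ (19 / 4 : ℝ) * B ^ (η / 2) with hQdef
    have hQ0 : 0 ≤ Q := by positivity
    calc _ ≤ 60 * M ^ 2 * M' * (b ^ (19 / 4 : ℝ) * G) * (C₂ * Real.log B) +
          4 * ε ^ 2 * (Q * (Real.log B / Real.log 2)) := by
          gcongr
          exact hb3.trans (le_mul_of_one_le_right hQ0 hlog1)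
      _ = C₁ * (Q * Real.log B) := by rw [hC₁, hQdef, hG]; field_simp
      _ ≤ C₁ * ((K ^ (1 / 4 : ℝ) * ((b : ℝ) ^ (23 / 8 : ℝ) * B ^ (3 / 4 * η))) * Real.log B) := by
          gcongr
      _ = _ := by ring
  have hs0 : 0 < s * (s - 1) := mul_pos (by linarith) (by linarith)
  have hs1' : 0 < (s + w) * (s + w - 1) := mul_pos (by linarith) (by linarith)
  have est1 := est _ (by positivity) le_rfl (hA1.trans (by gcongr))
  have est2 := est _ (by positivity) hYY hA1
  have hmain : 3 / (2 * Real.pi ^ 2) * (Psi b * Psi a * Psi (b - a) /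
      ((b : ℝ) * (a : ℝ) ^ (1 / 2 : ℝ))) * ε * B ^ η =
      3 / Real.pi ^ 2 * (κ * T / (2 * s)) * (Psi b * Psi a * Psi (b - a)) := by
    rw [hA, ← Real.sqrt_eq_rpow]
    field_simp
  have hlow' : ((heightSector a b s w (T / ((s + w) * (s + w - 1)))).card : ℝ) ≤
      (zoomSet a b ε B r).ncard := by exact_mod_cast hlow
  have hup' : ((zoomSet a b ε B r).ncard : ℝ) ≤
      (heightSector a b s w (T / (s * (s - 1)))).card := by exact_mod_cast hup
  refine ⟨hlog2.trans_le hL, hfin, ?_⟩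
  rw [hmain]
  rw [abs_le] at est1 est2 ⊢
  constructor <;> linarith

theorem zoomAnnulus_eq_diff (a b : ℕ) {ε₁ ε₂ : ℝ} (B r : ℝ) :
    zoomAnnulus a b ε₁ ε₂ B r = zoomSet a b ε₁ B r \ zoomSet a b ε₂ B r := by
  ext p
  simp only [zoomAnnulus, zoomSet, Set.mem_sdiff, Set.mem_ofPred_eq]
  grind

theorem zoomSet_mono (a b : ℕ) {ε₁ ε₂ : ℝ} (h : ε₂ ≤ ε₁) (B r : ℝ) :
    zoomSet a b ε₂ B r ⊆ zoomSet a b ε₁ B r := fun _ hp =>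
  ⟨hp.1, hp.2.1, hp.2.2.1, hp.2.2.2.1, hp.2.2.2.2.1, hp.2.2.2.2.2.1.trans h, hp.2.2.2.2.2.2⟩

theorem mainTheorem7 (τ₁ τ₂ ε₁ ε₂ δ : ℝ) (hτ₂ : 1 < τ₂) (hτ : τ₂ < τ₁)
    (hε₂ : 0 < ε₂) (hε : ε₂ < ε₁) (hδ : 0 < δ) :
    ∃ C : ℝ, ∀ (r : ℝ) (a b : ℕ) (B : ℝ),
      2 < r → r < 144 / 55 →
      0 < a → a < b → Nat.Coprime a b → ¬ (IsSquare a ∧ IsSquare b) →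
      τ₂ ^ 2 < (b : ℝ) / a → (b : ℝ) / a < τ₁ ^ 2 →
      0 < B →
      (b : ℝ) ^ (17 / 2 : ℝ) ≤ 16 * τ₂ / (τ₁ - 1) * B ^ (1 / 2 - 1 / r) →
      (zoomSet a b ε₁ B r).Finite ∧ (zoomSet a b ε₂ B r).Finite ∧
      ((zoomAnnulus a b ε₁ ε₂ B r).ncard : ℝ) =
        ((zoomSet a b ε₁ B r).ncard : ℝ) - ((zoomSet a b ε₂ B r).ncard : ℝ) ∧
      |((zoomAnnulus a b ε₁ ε₂ B r).ncard : ℝ) -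
          3 / (2 * Real.pi ^ 2) * (Psi b * Psi a * Psi (b - a) / ((b : ℝ) * (a : ℝ) ^ (1 / 2 : ℝ))) *
            (ε₁ - ε₂) * B ^ (1 / 2 - 1 / r)| ≤
        C * ((b : ℝ) ^ (23 / 8 + δ) * B ^ (3 / 4 * (1 / 2 - 1 / r)) * Real.log B) := by
  obtain ⟨C₁, hC₁, h₁⟩ := exists_abs_ncard_zoomSet_sub_le hτ₂ hτ (hε₂.trans hε)
  obtain ⟨C₂, hC₂, h₂⟩ := exists_abs_ncard_zoomSet_sub_le hτ₂ hτ hε₂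
  refine ⟨C₁ + C₂, fun r a b B hr2 hr ha hab hcop hsq hba2 hba1 hB hbig => ?_⟩
  obtain ⟨hlog, hfin₁, g₁⟩ := h₁ r a b B hr2 hr ha hab hcop hsq hba2 hba1 hB hbig
  obtain ⟨-, hfin₂, g₂⟩ := h₂ r a b B hr2 hr ha hab hcop hsq hba2 hba1 hB hbig
  have hcard : ((zoomAnnulus a b ε₁ ε₂ B r).ncard : ℝ) =
      ((zoomSet a b ε₁ B r).ncard : ℝ) - ((zoomSet a b ε₂ B r).ncard : ℝ) := by
    have h := Set.ncard_sdiff_add_ncard_of_subset (zoomSet_mono a b hε.le B r) hfin₁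
    rw [zoomAnnulus_eq_diff, ← h]
    push_cast
    ring
  refine ⟨hfin₁, hfin₂, hcard, ?_⟩
  -- Each count has error exponent `23/8` in `b`; since `b ≥ 1`, adding `δ` only weakens the bound.
  have hb : (b : ℝ) ^ (23 / 8 : ℝ) ≤ (b : ℝ) ^ (23 / 8 + δ) :=
    Real.rpow_le_rpow_of_exponent_le (by exact_mod_cast ha.trans hab) (by linarith)
  have hle : (C₁ + C₂) * ((b : ℝ) ^ (23 / 8 : ℝ) * B ^ (3 / 4 * (1 / 2 - 1 / r)) * Real.log B) ≤
      (C₁ + C₂) * ((b : ℝ) ^ (23 / 8 + δ) * B ^ (3 / 4 * (1 / 2 - 1 / r)) * Real.log B) := by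
    gcongr
  refine le_trans ?_ hle
  rw [hcard]
  rw [abs_le] at g₁ g₂ ⊢
  constructor <;> linarith
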